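/- **Theorem (Lyapunov-based ISS small-gain theorem).** *Notation.* $\mathcal K$ is the set of continuous strictly increasing $\gamma:[0,\infty)\to[0,\infty)$ with $\gamma(0)=0$; $\mathcal K_\infty$ is the set of unbounded $\gamma\in\mathcal K$; $\mathcal L$ is the set of continuous strictly decreasing $\gamma:[0,\infty)\to[0,\infty)$ with $\gamma(t)\to0$ as $t\to\infty$; $\mathcal{KL}$ is the set of continuous $\beta:[0,\infty)^2\to[0,\infty)$ with $\beta(\cdot,t)\in\mathcal K$ for all $t\ge0$ and $\beta(r,\cdot)\in\mathcal L$ for all $r>0$; $\mathcal P$ is the set of continuous $\alpha:[0,\infty)\to[0,\infty)$ with $\alpha(0)=0$ and $\alpha(r)>0$ for $r>0$. For a Banach space $W$, $PC_b(\mathbb R_+,W)$ is the space of globally bounded, piecewise continuous, right-continuous functions $w:[0,\infty)\to W$ (finitely many discontinuities on each bounded interval, with one-sided limits), with $\|w\|=\sup_{t\ge0}\|w(t)\|$. *Systems.* Let $X_1,X_2,U$ be Banach spaces, let $A_i$ be the generator of a $C_0$-semigroup $T_i$ on $X_i$, let $f_i:X_1\times X_2\times U\to X_i$ ($i=1,2$),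 and put $\mathcal U=PC_b(\mathbb R_+,U)$. Consider the interconnection $$\dot x_1=A_1x_1+f_1(x_1,x_2,u),\qquad \dot x_2=A_2x_2+f_2(x_1,x_2,u),\qquad u\in\mathcal U,$$ that is, $\dot x=Ax+f(x,u)$ on $X=X_1\times X_2$ with $\|x\|=\|x_1\|+\|x_2\|$, $A=\mathrm{diag}(A_1,A_2)$, $f=(f_1,f_2)$. Solutions are mild solutions: a solution of $\dot x=Ax+f(x,w)$ on $[0,b)$, $b\in(0,\infty]$, with initial state $x_0$ and input $w$ is a continuous $x:[0,b)\to X$ with $x(t)=T(t)x_0+\int_0^tT(t-s)f(x(s),w(s))\,ds$ for all $t\in[0,b)$; it is maximal if it does not extend to a solution on a larger interval $[0,b')$. The $i$-th subsystem is $\dot x_i=A_ix_i+f_i(x_1,x_2,u)$ with state space $X_i$ and inputs $(x_{3-i},u)\in PC_b(\mathbb R_+,X_{3-i})\times\mathcal U$; write $\phi_i(t,x_i,(v,u))$ for its solution at time $t$ with initial state $x_i$ and input $(v,u)$. *Assumptions on the dynamics.* 1. $f$ is continuous on $X\times U$. 2. $f_i$ is Lipschitz continuous with respect to $x_i$ on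 bounded subsets, $i=1,2$. 3. Each subsystem is forward complete: for every initial state and every input its solution exists on $[0,\infty)$. 4. For every $x\in X$ and $u\in\mathcal U$ the interconnection has a unique maximal solution. 5. Every maximal solution of the interconnection that is bounded on its whole domain is defined on $[0,\infty)$. *Lyapunov functions.* For $i=1,2$ let $V_i:X_i\to[0,\infty)$ be continuous and let $\psi_{i1},\psi_{i2}\in\mathcal K_\infty$ satisfy $\psi_{i1}(\|x_i\|)\le V_i(x_i)\le\psi_{i2}(\|x_i\|)$ for all $x_i\in X_i$. For an input $(v,u)$ of the $i$-th subsystem, the Lie derivative of $V_i$ at $x_i$ is $$\dot V_{i,(v,u)}(x_i)=\limsup_{t\to+0}\tfrac1t\bigl(V_i(\phi_i(t,x_i,(v,u)))-V_i(x_i)\bigr)\in[-\infty,\infty].$$ Suppose that there are $\chi_{12},\chi_{21}\in\mathcal K_\infty\cup\{0\}$, $\chi_{1u},\chi_{2u}\in\mathcal K$ and $\alpha_1,\alpha_2\in\mathcal P$ such that for all $u\in\mathcal U$: $$V_1(x_1)>\max\{\chi_{12}(V_2(v(0))),\chi_{1u}(\|u\|)\}\ \Longrightarrow\ \dot V_{1,(v,u)}(x_1)\le-\alpha_1(V_1(x_1))\qquad\text{for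 all }x_1\in X_1,\ v\in PC_b(\mathbb R_+,X_2),$$ $$V_2(x_2)>\max\{\chi_{21}(V_1(v(0))),\chi_{2u}(\|u\|)\}\ \Longrightarrow\ \dot V_{2,(v,u)}(x_2)\le-\alpha_2(V_2(x_2))\qquad\text{for all }x_2\in X_2,\ v\in PC_b(\mathbb R_+,X_1).$$ *Conclusion.* If the small-gain condition $\chi_{12}\circ\chi_{21}(r)<r$ holds for all $r>0$, then the interconnection is input-to-state stable (ISS): for all $x\in X$, $u\in\mathcal U$ its solution $\phi(\cdot,x,u)$ exists on $[0,\infty)$, and there are $\beta\in\mathcal{KL}$ and $\gamma\in\mathcal K_\infty$ such that $$\|\phi(t,x,u)\|\le\beta(\|x\|,t)+\gamma(\|u\|)\qquad\text{for all }x\in X,\ u\in\mathcal U,\ t\ge0.$$ -/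

import Mathlib

open Set Filter Topology
open scoped NNReal

/-! ### Comparison functions

Functions on `[0, ∞)` are represented by functions `ℝ → ℝ` of which only the values on `[0, ∞)`
are ever used. -/

/-- Class `𝒦`. Nonnegativity on `[0, ∞)` follows from `γ 0 = 0` and monotonicity. -/
structure ClassK (γ : ℝ → ℝ) : Prop where
  continuousOn : ContinuousOn γ (Ici 0)
  map_zero : γ 0 = 0
  strictMonoOn : StrictMonoOn γ (Ici 0)

/-- Class `𝒦_∞`. -/
structure ClassKInf (γ : ℝ → ℝ) : Prop extends ClassK γ where
  unbounded : ¬ BddAbove (γ '' Ici 0)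

/-- Class `ℒ`. Nonnegativity on `[0, ∞)` follows from the other two properties. -/
structure ClassL (γ : ℝ → ℝ) : Prop where
  continuousOn : ContinuousOn γ (Ici 0)
  strictAntiOn : StrictAntiOn γ (Ici 0)
  tendsto_zero : Tendsto γ atTop (𝓝 0)

/-- Class `𝒦ℒ`. -/
structure ClassKL (β : ℝ → ℝ → ℝ) : Prop where
  continuousOn : ContinuousOn (fun p : ℝ × ℝ => β p.1 p.2) (Ici 0 ×ˢ Ici 0)
  classK : ∀ t, 0 ≤ t → ClassK fun r => β r t
  classL : ∀ r, 0 < r → ClassL (β r)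

/-- Positive definite functions on `[0, ∞)`. -/
structure ClassPD (α : ℝ → ℝ) : Prop where
  continuousOn : ContinuousOn α (Ici 0)
  map_zero : α 0 = 0
  pos : ∀ r, 0 < r → 0 < α r

/-! ### Input space -/

/-- Globally bounded, piecewise continuous, right-continuous functions `[0, ∞) → W`. Only the
values of `w` on `[0, ∞)` matter. Piecewise continuous: finitely many discontinuities on each
bounded interval, all of them with one-sided limits. -/
structure IsPCb {W : Type*} [NormedAddCommGroup W] (w : ℝ → W) : Prop where
  bounded : ∃ C, ∀ t, 0 ≤ t → ‖w t‖ ≤ C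
  right_continuous : ∀ t, 0 ≤ t → ContinuousWithinAt w (Ici t) t
  left_limit : ∀ t, 0 < t → ∃ l, Tendsto w (𝓝[<] t) (𝓝 l)
  finite_discontinuities :
    ∀ b : ℝ, {t ∈ Icc 0 b | ¬ ContinuousWithinAt w (Ici 0) t}.Finite

/-- The norm of an input, `sup_{t ≥ 0} ‖w t‖`. -/
noncomputable def inputNorm {W : Type*} [NormedAddCommGroup W] (w : ℝ → W) : ℝ :=
  ⨆ t : Ici (0 : ℝ), ‖w t‖

/-! ### Strongly continuous semigroups -/

/-- A strongly continuous semigroup of bounded linear operators. -/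
structure C0Semigroup (X : Type*) [NormedAddCommGroup X] [NormedSpace ℝ X] where
  toFun : ℝ≥0 → X →L[ℝ] X
  map_zero : toFun 0 = ContinuousLinearMap.id ℝ X
  map_add : ∀ s t, toFun (s + t) = (toFun s).comp (toFun t)
  strongly_continuous : ∀ x, Continuous fun t => toFun t x

/-- `(T(h) x - x) / h`. -/
noncomputable def C0Semigroup.diffQuotient {X : Type*} [NormedAddCommGroup X] [NormedSpace ℝ X]
    (T : C0Semigroup X) (x : X) (h : ℝ) : X :=
  h⁻¹ • (T.toFun h.toNNReal x - x)

/-- The (in general unbounded) operator `A` is the infinitesimal generator of `T`. -/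
structure C0Semigroup.IsGenerator {X : Type*} [NormedAddCommGroup X] [NormedSpace ℝ X]
    (T : C0Semigroup X) (A : X →ₗ.[ℝ] X) : Prop where
  mem_domain : ∀ x, x ∈ A.domain ↔ ∃ y, Tendsto (T.diffQuotient x) (𝓝[>] 0) (𝓝 y)
  tendsto : ∀ x : A.domain, Tendsto (T.diffQuotient (x : X)) (𝓝[>] 0) (𝓝 (A x))

/-! ### Semilinear evolution equations `ẋ = A x + f(x, w)` -/

/-- Data of `ẋ = A x + f(x, w)` with `A` the generator of a `C₀`-semigroup `T` on the state space
`X`, and `W` the space of input values. -/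
structure SemilinearSystem (X W : Type*) [NormedAddCommGroup X] [NormedSpace ℝ X] where
  A : X →ₗ.[ℝ] X
  T : C0Semigroup X
  isGenerator : T.IsGenerator A
  f : X → W → X

/-- The time interval `[0, b)`, for `b ∈ (0, ∞]`. -/
def timeInterval (b : EReal) : Set ℝ := {t | 0 ≤ t ∧ (t : EReal) < b}

namespace SemilinearSystem

variable {X W : Type*} [NormedAddCommGroup X] [NormedSpace ℝ X] [NormedAddCommGroup W]

/-- `ξ` is a (mild) solution on `[0, b)` with initial state `x` and input `w`:
`ξ(t) = T(t) x + ∫₀ᵗ T(t - s) f(ξ(s), w(s)) ds`. -/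
structure IsSolution (S : SemilinearSystem X W) (x : X) (w : ℝ → W) (b : EReal) (ξ : ℝ → X) :
    Prop where
  pos : 0 < b
  continuousOn : ContinuousOn ξ (timeInterval b)
  integrable : ∀ t ∈ timeInterval b, IntervalIntegrable
    (fun s => S.T.toFun (t - s).toNNReal (S.f (ξ s) (w s))) MeasureTheory.volume 0 t
  eq : ∀ t ∈ timeInterval b,
    ξ t = S.T.toFun t.toNNReal x + ∫ s in (0 : ℝ)..t, S.T.toFun (t - s).toNNReal (S.f (ξ s) (w s))

/-- `ξ` on `[0, b)` is a maximal solution: no solution on a larger interval extends it. -/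
def IsMaximalSolution (S : SemilinearSystem X W) (x : X) (w : ℝ → W) (b : EReal) (ξ : ℝ → X) :
    Prop :=
  S.IsSolution x w b ξ ∧
    ∀ b' ξ', b ≤ b' → S.IsSolution x w b' ξ' → EqOn ξ' ξ (timeInterval b) → b' = b

/-- For every initial state and every input there is a unique maximal solution. -/
def WellPosed (S : SemilinearSystem X W) : Prop :=
  ∀ (x : X) (w : ℝ → W), IsPCb w → ∃ b ξ, S.IsMaximalSolution x w b ξ ∧
    ∀ b' ξ', S.IsMaximalSolution x w b' ξ' → b' = b ∧ EqOn ξ' ξ (timeInterval b)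

/-- Boundedness-implies-continuation property. -/
def BIC (S : SemilinearSystem X W) : Prop :=
  ∀ (x : X) (w : ℝ → W) (b : EReal) (ξ : ℝ → X), IsPCb w → S.IsMaximalSolution x w b ξ →
    (∃ C, ∀ t ∈ timeInterval b, ‖ξ t‖ ≤ C) → b = ⊤

/-- Every initial state and every input admit a solution on `[0, ∞)`. -/
def ForwardComplete (S : SemilinearSystem X W) : Prop :=
  ∀ (x : X) (w : ℝ → W), IsPCb w → ∃ ξ, S.IsSolution x w ⊤ ξ

/-- Input-to-state stability: solutions exist on `[0, ∞)` for all initial states and inputs, and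
satisfy `‖ξ(t)‖ ≤ β(‖x‖, t) + γ(‖w‖)` with `β ∈ 𝒦ℒ` and `γ ∈ 𝒦_∞`. -/
def IsISS (S : SemilinearSystem X W) : Prop :=
  S.ForwardComplete ∧
    ∃ (β : ℝ → ℝ → ℝ) (γ : ℝ → ℝ), ClassKL β ∧ ClassKInf γ ∧
      ∀ (x : X) (w : ℝ → W), IsPCb w → ∀ ξ, S.IsSolution x w ⊤ ξ →
        ∀ t, 0 ≤ t → ‖ξ t‖ ≤ β ‖x‖ t + γ (inputNorm w)

end SemilinearSystem

/-- The Lie derivative `limsup_{t → 0+} (V(ξ(t)) - V(ξ(0))) / t` of `V` along the trajectory `ξ`,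
an extended real number. -/
noncomputable def lieDerivative {X : Type*} (V : X → ℝ) (ξ : ℝ → X) : EReal :=
  limsup (fun t : ℝ => (((V (ξ t) - V (ξ 0)) / t : ℝ) : EReal)) (𝓝[>] 0)

/-! ### Coupled systems -/

section Coupling

variable {X₁ X₂ U : Type*} [NormedAddCommGroup X₁] [NormedSpace ℝ X₁]
  [NormedAddCommGroup X₂] [NormedSpace ℝ X₂]

/-- The diagonal semigroup on `X₁ × X₂` with the norm `‖x₁‖ + ‖x₂‖`. -/
noncomputable def C0Semigroup.diag (T₁ : C0Semigroup X₁) (T₂ : C0Semigroup X₂) :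
    C0Semigroup (WithLp 1 (X₁ × X₂)) where
  toFun t :=
    (WithLp.prodContinuousLinearEquiv 1 ℝ X₁ X₂).symm.toContinuousLinearMap.comp
      (((T₁.toFun t).prodMap (T₂.toFun t)).comp
        (WithLp.prodContinuousLinearEquiv 1 ℝ X₁ X₂).toContinuousLinearMap)
  map_zero := by
    ext x : 1
    rw [T₁.map_zero, T₂.map_zero]
    rfl
  map_add s t := by
    ext x : 1
    rw [T₁.map_add, T₂.map_add]
    rfl
  strongly_continuous x := by
    refine (WithLp.prod_continuous_toLp 1 X₁ X₂).comp ?_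
    exact (T₁.strongly_continuous x.fst).prodMk (T₂.strongly_continuous x.snd)

/-- `diag(A₁, A₂)` with domain `D(A₁) × D(A₂)`. -/
noncomputable def diagOperator (A₁ : X₁ →ₗ.[ℝ] X₁) (A₂ : X₂ →ₗ.[ℝ] X₂) :
    WithLp 1 (X₁ × X₂) →ₗ.[ℝ] WithLp 1 (X₁ × X₂) where
  domain := (A₁.domain.prod A₂.domain).comap (WithLp.linearEquiv 1 ℝ (X₁ × X₂)).toLinearMap
  toFun :=
    { toFun := fun x => WithLp.toLp 1 (A₁ ⟨x.1.fst, x.2.1⟩, A₂ ⟨x.1.snd, x.2.2⟩)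
      map_add' := fun x y => by
        rw [← WithLp.toLp_add, Prod.mk_add_mk, ← A₁.map_add, ← A₂.map_add]
        rfl
      map_smul' := fun c x => by
        rw [RingHom.id_apply, ← WithLp.toLp_smul, Prod.smul_mk, ← A₁.map_smul, ← A₂.map_smul]
        rfl }

theorem C0Semigroup.IsGenerator.diag {T₁ : C0Semigroup X₁} {T₂ : C0Semigroup X₂}
    {A₁ : X₁ →ₗ.[ℝ] X₁} {A₂ : X₂ →ₗ.[ℝ] X₂} (h₁ : T₁.IsGenerator A₁) (h₂ : T₂.IsGenerator A₂) :
    (T₁.diag T₂).IsGenerator (diagOperator A₁ A₂) := by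
  have key : ∀ (x y : WithLp 1 (X₁ × X₂)),
      Tendsto ((T₁.diag T₂).diffQuotient x) (𝓝[>] 0) (𝓝 y) ↔
        Tendsto (T₁.diffQuotient x.fst) (𝓝[>] 0) (𝓝 y.fst) ∧
          Tendsto (T₂.diffQuotient x.snd) (𝓝[>] 0) (𝓝 y.snd) := by
    intro x y
    constructor
    · intro h
      exact ⟨((WithLp.continuous_fst 1 X₁ X₂).tendsto y).comp h,
        ((WithLp.continuous_snd 1 X₁ X₂).tendsto y).comp h⟩
    · rintro ⟨ha, hb⟩
      exact ((WithLp.prod_continuous_toLp 1 X₁ X₂).tendsto (y.fst, y.snd)).comp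
        (ha.prodMk_nhds hb)
  refine ⟨fun x => ?_, fun x => ?_⟩
  · have hd : x ∈ (diagOperator A₁ A₂).domain ↔ x.fst ∈ A₁.domain ∧ x.snd ∈ A₂.domain := Iff.rfl
    rw [hd, h₁.mem_domain, h₂.mem_domain]
    constructor
    · rintro ⟨⟨a, ha⟩, b, hb⟩
      exact ⟨WithLp.toLp 1 (a, b), (key _ _).2 ⟨ha, hb⟩⟩
    · rintro ⟨y, hy⟩
      exact ⟨⟨_, ((key _ _).1 hy).1⟩, _, ((key _ _).1 hy).2⟩
  · exact (key _ _).2 ⟨h₁.tendsto ⟨x.1.fst, x.2.1⟩, h₂.tendsto ⟨x.1.snd, x.2.2⟩⟩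

end Coupling

/-- Data of the coupled system `ẋ₁ = A₁ x₁ + f₁(x₁, x₂, u)`, `ẋ₂ = A₂ x₂ + f₂(x₁, x₂, u)`, with
`Aᵢ` the generator of a `C₀`-semigroup `Tᵢ` on `Xᵢ`. -/
structure CoupledSystem (X₁ X₂ U : Type*) [NormedAddCommGroup X₁] [NormedSpace ℝ X₁]
    [NormedAddCommGroup X₂] [NormedSpace ℝ X₂] where
  A₁ : X₁ →ₗ.[ℝ] X₁
  A₂ : X₂ →ₗ.[ℝ] X₂
  T₁ : C0Semigroup X₁
  T₂ : C0Semigroup X₂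
  isGenerator₁ : T₁.IsGenerator A₁
  isGenerator₂ : T₂.IsGenerator A₂
  f₁ : X₁ → X₂ → U → X₁
  f₂ : X₁ → X₂ → U → X₂

namespace CoupledSystem

variable {X₁ X₂ U : Type*} [NormedAddCommGroup X₁] [NormedSpace ℝ X₁]
  [NormedAddCommGroup X₂] [NormedSpace ℝ X₂]

/-- The first subsystem, with `(x₂, u)` as its input. -/
def subsystem₁ (S : CoupledSystem X₁ X₂ U) : SemilinearSystem X₁ (X₂ × U) where
  A := S.A₁
  T := S.T₁
  isGenerator := S.isGenerator₁
  f x w := S.f₁ x w.1 w.2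

/-- The second subsystem, with `(x₁, u)` as its input. -/
def subsystem₂ (S : CoupledSystem X₁ X₂ U) : SemilinearSystem X₂ (X₁ × U) where
  A := S.A₂
  T := S.T₂
  isGenerator := S.isGenerator₂
  f x w := S.f₂ w.1 x w.2

/-- The interconnection `ẋ = A x + f(x, u)` on `X = X₁ × X₂` with the norm `‖x₁‖ + ‖x₂‖`, where
`A = diag(A₁, A₂)` and `f = (f₁, f₂)`. -/
noncomputable def interconnection (S : CoupledSystem X₁ X₂ U) :
    SemilinearSystem (WithLp 1 (X₁ × X₂)) U where
  A := diagOperator S.A₁ S.A₂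
  T := S.T₁.diag S.T₂
  isGenerator := S.isGenerator₁.diag S.isGenerator₂
  f x u := WithLp.toLp 1 (S.f₁ x.fst x.snd u, S.f₂ x.fst x.snd u)

end CoupledSystem

/-! ### Comparison functions -/

/-! The small-gain condition yields a path r ↦ (σ₁ r, σ₂ r) with χ₁₂(σ₂ r) < σ₁ r and χ₂₁(σ₁ r) < σ₂
r for r > 0 (`exists_smallGain_path`). Suppose (V₁, V₂) lies in the box [0, σ₁ m] × [0, σ₂ m], with
m above a threshold determined by ‖u‖. On a face Vᵢ = σᵢ m the decay implication for Vᵢ is active,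
so Vᵢ falls at rate at least αᵢ(σᵢ m). A box that shrinks more slowly therefore traps the
trajectory: take m = max(r(t), s) with ṙ = -ρ(r) and ρ < αᵢ ∘ σᵢ (`eventually_le_path`,
`exists_classKL_bound`). The flow r gives the 𝒦ℒ part of the estimate (`exists_classKL_flow`), the
constant s the gain part.

The boxes are the sublevel sets of max{σ₁⁻¹(V₁), σ₂⁻¹(V₂)}, the usual Lyapunov function of the
interconnection. Working with boxes avoids differentiating it: normalized by σ₁ + σ₂ = id, both
increasing components are 1-Lipschitz, which is all the regularity required.

The decay hypotheses speak only of time 0 and of bounded inputs on the whole half-line.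
`SemilinearSystem.IsSolutionOn.eventually_decay` transports them to later times by shifting,
freezing the other component and extending the solution. The resulting estimate holds on the domain
of any solution, so maximal solutions are bounded and hence global. -/

namespace ClassK

variable {γ δ : ℝ → ℝ}

theorem mono (h : ClassK γ) {r s : ℝ} (hr : 0 ≤ r) (hrs : r ≤ s) : γ r ≤ γ s :=
  h.strictMonoOn.monotoneOn hr (hr.trans hrs) hrs

theorem nonneg (h : ClassK γ) {r : ℝ} (hr : 0 ≤ r) : 0 ≤ γ r := by
  simpa [h.map_zero] using h.mono le_rfl hr

theorem pos (h : ClassK γ) {r : ℝ} (hr : 0 < r) : 0 < γ r := by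
  simpa [h.map_zero] using h.strictMonoOn (mem_Ici.2 le_rfl) (mem_Ici.2 hr.le) hr

theorem mapsTo (h : ClassK γ) : MapsTo γ (Ici 0) (Ici 0) := fun _ hr => h.nonneg hr

theorem comp (h : ClassK γ) (h' : ClassK δ) : ClassK fun r => γ (δ r) where
  continuousOn := h.continuousOn.comp h'.continuousOn h'.mapsTo
  map_zero := by rw [h'.map_zero, h.map_zero]
  strictMonoOn := h.strictMonoOn.comp h'.strictMonoOn h'.mapsTo

theorem add (h : ClassK γ) (h' : ClassK δ) : ClassK fun r => γ r + δ r where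
  continuousOn := h.continuousOn.add h'.continuousOn
  map_zero := by rw [h'.map_zero, h.map_zero, add_zero]
  strictMonoOn := h.strictMonoOn.add h'.strictMonoOn

theorem le_add_of_max (h : ClassK γ) {r s : ℝ} (hr : 0 ≤ r) (hs : 0 ≤ s) :
    γ (max r s) ≤ γ r + γ s := by
  have h₁ := h.nonneg hr
  have h₂ := h.nonneg hs
  rcases le_total r s with hrs | hrs
  · rw [max_eq_right hrs]; linarith
  · rw [max_eq_left hrs]; linarith

end ClassK

namespace ClassKInf

variable {γ δ : ℝ → ℝ}

theorem exists_lt (h : ClassKInf γ) (M : ℝ) : ∃ r, 0 ≤ r ∧ M < γ r := by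
  by_contra! hM
  exact h.unbounded ⟨M, by rintro _ ⟨r, hr, rfl⟩; exact hM r hr⟩

theorem of_le (h : ClassKInf γ) (hδ : ClassK δ) (hle : ∀ r, 0 ≤ r → γ r ≤ δ r) :
    ClassKInf δ where
  toClassK := hδ
  unbounded := by
    rintro ⟨M, hM⟩
    obtain ⟨r, hr, hr'⟩ := h.exists_lt M
    exact absurd ((hr'.trans_le (hle r hr)).trans_le (hM ⟨r, hr, rfl⟩)) (lt_irrefl _)

protected theorem id : ClassKInf fun r => r where
  continuousOn := continuousOn_id
  map_zero := rfl
  strictMonoOn := strictMonoOn_id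
  unbounded := by
    rintro ⟨M, hM⟩
    have := hM ⟨max M 0 + 1, mem_Ici.2 (by positivity), rfl⟩
    have := le_max_left M 0
    linarith

theorem add_classK (h : ClassKInf γ) (h' : ClassK δ) : ClassKInf fun r => γ r + δ r :=
  h.of_le (h.toClassK.add h') fun _ hr => le_add_of_nonneg_right (h'.nonneg hr)

theorem comp (h : ClassKInf γ) (h' : ClassKInf δ) : ClassKInf fun r => γ (δ r) where
  toClassK := h.toClassK.comp h'.toClassK
  unbounded := by
    rintro ⟨M, hM⟩
    obtain ⟨r, hr, hr'⟩ := h.exists_lt M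
    obtain ⟨s, hs, hs'⟩ := h'.exists_lt r
    have h₁ := hM ⟨s, hs, rfl⟩
    have h₂ := h.mono hr hs'.le
    simp only at h₁
    linarith

theorem surjOn (h : ClassKInf γ) : SurjOn γ (Ici 0) (Ici 0) := by
  intro y hy
  obtain ⟨r, hr, hr'⟩ := h.exists_lt y
  obtain ⟨s, hs, hs'⟩ := intermediate_value_Icc hr (h.continuousOn.mono Icc_subset_Ici_self)
    ⟨by rw [h.map_zero]; exact hy, hr'.le⟩
  exact ⟨s, hs.1, hs'⟩

/-- Continuity is automatic, because a monotone surjection has no jumps. This spares a separate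
continuity proof for inverses. -/
theorem of_surjOn (hmono : StrictMonoOn γ (Ici 0)) (hmaps : MapsTo γ (Ici 0) (Ici 0))
    (hsurj : SurjOn γ (Ici 0) (Ici 0)) : ClassKInf γ := by
  have h0 : γ 0 = 0 := by
    obtain ⟨r, hr, hr'⟩ := hsurj (mem_Ici.2 le_rfl)
    have := hmono.monotoneOn (mem_Ici.2 le_rfl) hr hr
    exact le_antisymm (this.trans_eq hr') (hmaps (mem_Ici.2 le_rfl))
  -- Extension by the identity to negative arguments gives a monotone surjection of the whole line.
  have hm : Monotone fun x => if 0 ≤ x then γ x else x := by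
    intro x y hxy
    by_cases hx : 0 ≤ x
    · simpa [hx, hx.trans hxy] using hmono.monotoneOn hx (hx.trans hxy) hxy
    · by_cases hy : 0 ≤ y
      · simpa [hx, hy] using (not_le.1 hx).le.trans (hmaps hy)
      · simpa [hx, hy] using hxy
  have hs : Function.Surjective fun x => if 0 ≤ x then γ x else x := by
    intro y
    by_cases hy : 0 ≤ y
    · obtain ⟨x, hx, rfl⟩ := hsurj hy
      exact ⟨x, if_pos hx⟩
    · exact ⟨y, if_neg hy⟩
  refine ⟨⟨?_, h0, hmono⟩, ?_⟩
  · exact (hm.continuous_of_surjective hs).continuousOn.congr fun x hx => (if_pos hx).symm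
  · rintro ⟨M, hM⟩
    obtain ⟨x, hx, hx'⟩ := hsurj (mem_Ici.2 (by positivity : 0 ≤ |M| + 1))
    have := hM ⟨x, hx, hx'⟩
    have := le_abs_self M
    linarith

theorem exists_inverse (h : ClassKInf γ) :
    ∃ δ, ClassKInf δ ∧ (∀ r, 0 ≤ r → γ (δ r) = r) ∧ ∀ r, 0 ≤ r → δ (γ r) = r := by
  classical
  have hex : ∀ y : ℝ, 0 ≤ y → ∃ r, 0 ≤ r ∧ γ r = y := fun y hy => h.surjOn (mem_Ici.2 hy)
  choose! δ hδ₀ hδ using hex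
  have hinv : ∀ r, 0 ≤ r → δ (γ r) = r := fun r hr =>
    h.strictMonoOn.injOn (hδ₀ _ (h.nonneg hr)) hr (hδ _ (h.nonneg hr))
  refine ⟨δ, of_surjOn (fun x hx y hy hxy => ?_) (fun x hx => hδ₀ x hx) (fun x hx =>
    ⟨γ x, h.nonneg hx, hinv x hx⟩), hδ, hinv⟩
  by_contra! hle
  have := h.mono (hδ₀ y hy) hle
  rw [hδ x hx, hδ y hy] at this
  exact absurd hxy this.not_gt

end ClassKInf

/-- Serves to translate a decay estimate for the path parameter into one for norms: θ acts on the
initial state, ω on the result. -/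
theorem ClassKL.comp {β : ℝ → ℝ → ℝ} {ω θ : ℝ → ℝ} (hβ : ClassKL β) (hω : ClassK ω)
    (hθ : ClassK θ) : ClassKL fun r t => ω (β (θ r) t) where
  continuousOn := by
    refine hω.continuousOn.comp (hβ.continuousOn.comp ((hθ.continuousOn.comp continuousOn_fst
      fun p hp => hp.1).prodMk continuousOn_snd) fun p hp => ⟨hθ.nonneg hp.1, hp.2⟩) ?_
    exact fun p hp => (hβ.classK p.2 hp.2).nonneg (hθ.nonneg hp.1)
  classK t ht := hω.comp ((hβ.classK t ht).comp hθ)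
  classL r hr := by
    have hL := hβ.classL (θ r) (hθ.pos hr)
    have hm : MapsTo (β (θ r)) (Ici 0) (Ici 0) := fun t ht =>
      (hβ.classK t ht).nonneg (hθ.nonneg hr.le)
    refine ⟨hω.continuousOn.comp hL.continuousOn hm, fun s hs t ht hst =>
      hω.strictMonoOn (hm ht) (hm hs) (hL.strictAntiOn hs ht hst), ?_⟩
    have h0 := hω.continuousOn 0 (mem_Ici.2 le_rfl)
    rw [ContinuousWithinAt, hω.map_zero] at h0
    exact h0.comp (tendsto_nhdsWithin_iff.2 ⟨hL.tendsto_zero,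
      (eventually_ge_atTop 0).mono fun t ht => hm ht⟩)

theorem ClassKL.le_initial {β : ℝ → ℝ → ℝ} (hβ : ClassKL β) {r t : ℝ} (hr : 0 ≤ r)
    (ht : 0 ≤ t) : β r t ≤ β r 0 := by
  rcases hr.eq_or_lt with rfl | hr
  · rw [(hβ.classK t ht).map_zero, (hβ.classK 0 le_rfl).map_zero]
  · exact (hβ.classL r hr).strictAntiOn.antitoneOn (mem_Ici.2 le_rfl) (mem_Ici.2 ht) ht

/-- The flow of `ṙ = -ρ(r)` is a `𝒦ℒ` function, if `0 < ρ(r) ≤ r` for `r > 0`. -/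
theorem exists_classKL_flow {ρ : ℝ → ℝ} (hc : ContinuousOn ρ (Ioi 0))
    (hpos : ∀ r, 0 < r → 0 < ρ r) (hle : ∀ r, 0 < r → ρ r ≤ r) :
    ∃ β : ℝ → ℝ → ℝ, ClassKL β ∧ ∀ r, 0 < r → β r 0 = r ∧
      ∀ t, 0 < β r t ∧ HasDerivAt (β r) (-ρ (β r t)) t := by
  -- Separation of variables, since ρ is merely continuous. With r = exp y the equation becomes ẏ =
  -- -1 / g(y), so the primitive G of g satisfies G(y(t)) = G(y(0)) - t.
  set g : ℝ → ℝ := fun y => Real.exp y / ρ (Real.exp y) with hg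
  have hg1 : ∀ y, 1 ≤ g y := fun y =>
    (one_le_div (hpos _ (Real.exp_pos y))).2 (hle _ (Real.exp_pos y))
  have hgc : Continuous g := by
    refine Real.continuous_exp.div ?_ fun y => (hpos _ (Real.exp_pos y)).ne'
    exact hc.comp_continuous Real.continuous_exp fun y => Real.exp_pos y
  set G : ℝ → ℝ := fun y => ∫ s in (0 : ℝ)..y, g s with hG
  have hGd : ∀ y, HasDerivAt G (g y) y := fun y =>
    intervalIntegral.integral_hasDerivAt_right (hgc.intervalIntegrable _ _)
      (hgc.stronglyMeasurableAtFilter _ _) hgc.continuousAt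
  have hGc : Continuous G := continuous_iff_continuousAt.2 fun y => (hGd y).continuousAt
  have hGm : StrictMono G := strictMono_of_deriv_pos fun y => by
    rw [(hGd y).deriv]; linarith [hg1 y]
  -- As g ≥ 1, G grows at least linearly in both directions and is onto. Thus the flow exists for
  -- all times and does not reach 0 in finite time; this is where ρ r ≤ r enters.
  have hsub : Monotone fun y => G y - y := by
    refine monotone_of_deriv_nonneg (fun y => ((hGd y).sub (hasDerivAt_id y)).differentiableAt)
      fun y => ?_
    have : deriv (fun y => G y - y) y = g y - 1 := ((hGd y).sub (hasDerivAt_id y)).deriv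
    rw [this]; linarith [hg1 y]
  have hG0 : G 0 = 0 := by simp [hG]
  have hGs : Function.Surjective G := by
    refine hGc.surjective (tendsto_atTop_mono' _ ?_ tendsto_id)
      (tendsto_atBot_mono' _ ?_ tendsto_id)
    · filter_upwards [eventually_ge_atTop 0] with y hy
      have := hsub hy
      simp only [hG0, id] at this ⊢
      linarith
    · filter_upwards [eventually_le_atBot 0] with y hy
      have := hsub hy
      simp only [hG0, id] at this ⊢
      linarith
  set e : ℝ ≃o ℝ := hGm.orderIsoOfSurjective G hGs with he
  have heG : ∀ y, e y = G y := fun y => rfl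
  have hGe : ∀ c, G (e.symm c) = c := fun c => e.apply_symm_apply c
  have hed : ∀ c, HasDerivAt e.symm (g (e.symm c))⁻¹ c := fun c =>
    HasDerivAt.of_local_left_inverse e.symm.continuous.continuousAt (hGd _)
      (by linarith [hg1 (e.symm c)]) (Eventually.of_forall hGe)
  set β : ℝ → ℝ → ℝ := fun r t =>
    if 0 < r then Real.exp (e.symm (G (Real.log r) - t)) else 0 with hβ
  have hβp : ∀ {r}, 0 < r → β r = fun t => Real.exp (e.symm (G (Real.log r) - t)) := by
    intro r hr; funext t; exact if_pos hr
  have hβn : ∀ {r}, r ≤ 0 → ∀ t, β r t = 0 := fun hr t => if_neg hr.not_gt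
  have hβ0 : ∀ r, 0 < r → β r 0 = r := by
    intro r hr
    rw [hβp hr]
    simp only [sub_zero]
    rw [← heG, e.symm_apply_apply, Real.exp_log hr]
  have hpos' : ∀ r, 0 < r → ∀ t, 0 < β r t := by
    intro r hr t
    rw [hβp hr]; exact Real.exp_pos _
  have hanti : ∀ r, 0 < r → StrictAnti (β r) := by
    intro r hr s t hst
    rw [hβp hr]
    exact Real.exp_lt_exp.2 (e.symm.strictMono (by linarith))
  have hjoint : ∀ r, 0 < r → ∀ t, ContinuousAt (fun p : ℝ × ℝ => β p.1 p.2) (r, t) := by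
    intro r hr t
    have h1 : ContinuousAt (fun p : ℝ × ℝ => Real.exp (e.symm (G (Real.log p.1) - p.2)))
        (r, t) := by
      refine Real.continuous_exp.continuousAt.comp (e.symm.continuous.continuousAt.comp ?_)
      refine (hGc.continuousAt.comp ?_).sub continuousAt_snd
      exact (Real.continuousAt_log hr.ne').comp' continuousAt_fst
    refine h1.congr ?_
    filter_upwards [continuousAt_fst.eventually (lt_mem_nhds hr)] with p hp
    exact (congrFun (hβp hp) p.2).symm
  have hle' : ∀ r, 0 ≤ r → ∀ t, 0 ≤ t → 0 ≤ β r t ∧ β r t ≤ r := by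
    intro r hr t ht
    rcases hr.eq_or_lt with rfl | hr
    · simp [hβn le_rfl]
    · exact ⟨(hpos' r hr t).le, ((hanti r hr).antitone ht).trans_eq (hβ0 r hr)⟩
  have hcont : ContinuousOn (fun p : ℝ × ℝ => β p.1 p.2) (Ici 0 ×ˢ Ici 0) := by
    rintro ⟨r, t⟩ ⟨hr, ht⟩
    rcases (mem_Ici.1 hr).eq_or_lt with h | hr
    · simp only at h
      subst h
      rw [ContinuousWithinAt]
      simp only [hβn le_rfl]
      -- At r = 0, where the logarithmic formula breaks down, joint continuity follows from 0 ≤ β r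
      -- t ≤ r.
      refine squeeze_zero' (g := fun p : ℝ × ℝ => p.1) ?_ ?_ ?_
      · filter_upwards [self_mem_nhdsWithin] with p hp using (hle' _ hp.1 _ hp.2).1
      · filter_upwards [self_mem_nhdsWithin] with p hp using (hle' _ hp.1 _ hp.2).2
      · exact continuousWithinAt_fst
    · exact (hjoint r hr t).continuousWithinAt
  refine ⟨β, ⟨hcont, fun t ht => ⟨?_, hβn le_rfl t, ?_⟩, fun r hr => ⟨?_, ?_, ?_⟩⟩,
    fun r hr => ⟨hβ0 r hr, fun t => ⟨hpos' r hr t, ?_⟩⟩⟩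
  · exact hcont.comp (continuousOn_id.prodMk continuousOn_const) fun r hr => ⟨hr, ht⟩
  · intro r hr s hs hrs
    have hs0 : 0 < s := lt_of_le_of_lt hr hrs
    rcases (mem_Ici.1 hr).eq_or_lt with h | hr
    · subst h
      simpa only [hβn le_rfl] using hpos' s hs0 t
    · simp only [hβp hr, hβp hs0]
      exact Real.exp_lt_exp.2 (e.symm.strictMono (sub_lt_sub_right
        (hGm (Real.log_lt_log hr hrs)) t))
  · exact hcont.comp (continuousOn_const.prodMk continuousOn_id) fun t ht => ⟨hr.le, ht⟩
  · exact (hanti r hr).strictAntiOn _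
  · rw [hβp hr]
    refine Real.tendsto_exp_atBot.comp (e.symm.tendsto_atBot.comp ?_)
    exact tendsto_atBot_add_const_left _ _ tendsto_neg_atTop_atBot
  · have h1 := ((hed (G (Real.log r) - t)).comp t ((hasDerivAt_id t).const_sub _)).exp
    rw [hβp hr]
    refine h1.congr_deriv ?_
    have := (hpos _ (Real.exp_pos (e.symm (G (Real.log r) - t)))).ne'
    simp only [hg, Function.comp_apply]
    field_simp

/-- A path `(σ₁, σ₂)`, parametrized by `σ₁ + σ₂`, along which the small-gain condition is
satisfied in both components. -/
theorem exists_smallGain_path {χ₁₂ χ₂₁ : ℝ → ℝ}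
    (hχ₁₂ : ClassKInf χ₁₂ ∨ ∀ r, 0 ≤ r → χ₁₂ r = 0)
    (hχ₂₁ : ClassKInf χ₂₁ ∨ ∀ r, 0 ≤ r → χ₂₁ r = 0)
    (hsg : ∀ r, 0 < r → χ₁₂ (χ₂₁ r) < r) :
    ∃ σ₁ σ₂ : ℝ → ℝ, ClassKInf σ₁ ∧ ClassKInf σ₂ ∧ (∀ r, 0 ≤ r → σ₁ r + σ₂ r = r) ∧
      ∀ r, 0 < r → χ₁₂ (σ₂ r) < σ₁ r ∧ χ₂₁ (σ₁ r) < σ₂ r := by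
  have hadd : ∀ {γ : ℝ → ℝ}, ClassKInf γ →
      ClassKInf fun r => γ r + χ₂₁ r := by
    intro γ hγ
    rcases hχ₂₁ with h | h
    · exact hγ.add_classK h.toClassK
    · refine ⟨⟨?_, ?_, ?_⟩, ?_⟩
      · exact hγ.continuousOn.congr fun r hr => by simp [h r hr]
      · simp [h 0 le_rfl, hγ.map_zero]
      · intro r hr s hs hrs
        simpa [h r hr, h s hs] using hγ.strictMonoOn hr hs hrs
      · have : (fun r => γ r + χ₂₁ r) '' Ici 0 = γ '' Ici 0 :=
          EqOn.image_eq fun r hr => by simp [h r hr]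
        rw [this]
        exact hγ.unbounded
  have hχ₂₁0 : ∀ r, 0 ≤ r → 0 ≤ χ₂₁ r := by
    rcases hχ₂₁ with h | h
    · exact fun r hr => h.nonneg hr
    · exact fun r hr => (h r hr).ge
  -- The graph of σ must lie strictly between χ₂₁ and χ₁₂⁻¹: take their average, or id + χ₂₁ if χ₁₂
  -- vanishes.
  obtain ⟨σ, hσ, hσ'⟩ : ∃ σ, ClassKInf σ ∧ ∀ r, 0 < r → χ₁₂ (σ r) < r ∧ χ₂₁ r < σ r := by
    rcases hχ₁₂ with h | h
    · obtain ⟨δ, hδ, hδ₁, hδ₂⟩ := h.exists_inverse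
      have hhalf : ClassKInf fun r : ℝ => r / 2 :=
        ClassKInf.of_surjOn (fun x _ y _ hxy => div_lt_div_of_pos_right hxy two_pos)
          (fun x hx => mem_Ici.2 (div_nonneg hx zero_le_two)) fun x hx =>
          ⟨2 * x, mem_Ici.2 (mul_nonneg zero_le_two hx), by ring⟩
      refine ⟨_, hhalf.comp (hadd hδ), fun r hr => ?_⟩
      have hlt : χ₂₁ r < δ r := by
        by_contra! hle
        have := h.mono (hδ.nonneg hr.le) hle
        rw [hδ₁ r hr.le] at this
        exact absurd (hsg r hr) this.not_gt
      have h0 := hχ₂₁0 r hr.le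
      refine ⟨?_, by linarith⟩
      calc χ₁₂ ((δ r + χ₂₁ r) / 2) < χ₁₂ (δ r) :=
            h.strictMonoOn (mem_Ici.2 (by linarith)) (mem_Ici.2 (by linarith)) (by linarith)
        _ = r := hδ₁ r hr.le
    · refine ⟨_, hadd ClassKInf.id, fun r hr => ⟨?_, by linarith⟩⟩
      rwa [h _ (add_nonneg hr.le (hχ₂₁0 r hr.le))]
  -- Reparametrization by r + σ r normalizes the sum of the components to the identity.
  obtain ⟨σ₁, hσ₁, h₁, -⟩ := (ClassKInf.id.add_classK hσ.toClassK).exists_inverse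
  refine ⟨σ₁, fun r => σ (σ₁ r), hσ₁, hσ.comp hσ₁, h₁, fun r hr => hσ' _ (hσ₁.pos hr)⟩

/-! ### Inputs -/

namespace IsPCb

variable {W W' : Type*} [NormedAddCommGroup W] [NormedAddCommGroup W']

theorem norm_le_inputNorm {w : ℝ → W} (hw : IsPCb w) {t : ℝ} (ht : 0 ≤ t) :
    ‖w t‖ ≤ inputNorm w := by
  obtain ⟨C, hC⟩ := hw.bounded
  exact le_ciSup (f := fun t : Ici (0 : ℝ) => ‖w t‖)
    ⟨C, by rintro _ ⟨s, rfl⟩; exact hC s s.2⟩ ⟨t, ht⟩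

theorem shift {w : ℝ → W} (hw : IsPCb w) {s : ℝ} (hs : 0 ≤ s) : IsPCb fun t => w (s + t) where
  bounded := by
    obtain ⟨C, hC⟩ := hw.bounded
    exact ⟨C, fun t ht => hC _ (add_nonneg hs ht)⟩
  right_continuous t ht := by
    refine (hw.right_continuous (s + t) (add_nonneg hs ht)).comp
      (continuous_const.add continuous_id).continuousWithinAt fun r hr => ?_
    exact mem_Ici.2 (add_le_add_right (mem_Ici.1 hr) s)
  left_limit t ht := by
    obtain ⟨l, hl⟩ := hw.left_limit (s + t) (by linarith)
    refine ⟨l, hl.comp (tendsto_nhdsWithin_iff.2 ⟨?_, ?_⟩)⟩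
    · exact ((continuous_const.add continuous_id).tendsto t).mono_left nhdsWithin_le_nhds
    · filter_upwards [self_mem_nhdsWithin] with r hr
      exact mem_Iio.2 (by have := mem_Iio.1 hr; linarith)
  finite_discontinuities b := by
    refine ((hw.finite_discontinuities (s + b)).preimage
      (add_right_injective s).injOn).subset ?_
    rintro t ⟨ht, hd⟩
    refine ⟨⟨add_nonneg hs ht.1, by linarith [ht.2]⟩, fun hc => hd ?_⟩
    exact hc.comp (continuous_const.add continuous_id).continuousWithinAt
      fun r hr => add_nonneg hs hr

theorem inputNorm_shift_le {w : ℝ → W} (hw : IsPCb w) {s : ℝ} (hs : 0 ≤ s) :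
    inputNorm (fun t => w (s + t)) ≤ inputNorm w :=
  ciSup_le fun t => hw.norm_le_inputNorm (add_nonneg hs t.2)

theorem of_continuous {w : ℝ → W} (hc : Continuous w) (hb : ∃ C, ∀ t, ‖w t‖ ≤ C) : IsPCb w where
  bounded := hb.imp fun _ h t _ => h t
  right_continuous _ _ := hc.continuousWithinAt
  left_limit t _ := ⟨w t, (hc.tendsto t).mono_left nhdsWithin_le_nhds⟩
  finite_discontinuities b := by
    convert finite_empty
    exact eq_empty_of_forall_notMem fun t ht => ht.2 hc.continuousWithinAt

theorem prodMk {w : ℝ → W} {w' : ℝ → W'} (hw : IsPCb w) (hw' : IsPCb w') :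
    IsPCb fun t => (w t, w' t) where
  bounded := by
    obtain ⟨C, hC⟩ := hw.bounded
    obtain ⟨C', hC'⟩ := hw'.bounded
    exact ⟨max C C', fun t ht => max_le_max (hC t ht) (hC' t ht)⟩
  right_continuous t ht := (hw.right_continuous t ht).prodMk (hw'.right_continuous t ht)
  left_limit t ht := by
    obtain ⟨l, hl⟩ := hw.left_limit t ht
    obtain ⟨l', hl'⟩ := hw'.left_limit t ht
    exact ⟨(l, l'), hl.prodMk_nhds hl'⟩
  finite_discontinuities b := by
    refine ((hw.finite_discontinuities b).union (hw'.finite_discontinuities b)).subset ?_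
    rintro t ⟨ht, hd⟩
    by_cases h : ContinuousWithinAt w (Ici 0) t
    · exact Or.inr ⟨ht, fun h' => hd (h.prodMk h')⟩
    · exact Or.inl ⟨ht, h⟩

end IsPCb

theorem inputNorm_nonneg {W : Type*} [NormedAddCommGroup W] (w : ℝ → W) : 0 ≤ inputNorm w :=
  Real.iSup_nonneg fun _ => norm_nonneg _

/-! ### Mild solutions on compact intervals -/

namespace SemilinearSystem

variable {X W : Type*} [NormedAddCommGroup X] [NormedSpace ℝ X]

/-- `ξ` is a mild solution on the compact interval `[0, τ]`. -/
structure IsSolutionOn (S : SemilinearSystem X W) (x : X) (w : ℝ → W) (τ : ℝ) (ξ : ℝ → X) :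
    Prop where
  continuousOn : ContinuousOn ξ (Icc 0 τ)
  integrable : ∀ t ∈ Icc 0 τ, IntervalIntegrable
    (fun s => S.T.toFun (t - s).toNNReal (S.f (ξ s) (w s))) MeasureTheory.volume 0 t
  eq : ∀ t ∈ Icc 0 τ,
    ξ t = S.T.toFun t.toNNReal x + ∫ s in (0 : ℝ)..t, S.T.toFun (t - s).toNNReal (S.f (ξ s) (w s))

variable {S : SemilinearSystem X W} {x : X} {w : ℝ → W} {τ : ℝ} {ξ : ℝ → X}

theorem IsSolutionOn.initial (h : S.IsSolutionOn x w τ ξ) (hτ : 0 ≤ τ) : ξ 0 = x := by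
  have := h.eq 0 ⟨le_rfl, hτ⟩
  simpa [S.T.map_zero] using this

theorem IsSolutionOn.mono (h : S.IsSolutionOn x w τ ξ) {τ' : ℝ} (hτ : τ' ≤ τ) :
    S.IsSolutionOn x w τ' ξ where
  continuousOn := h.continuousOn.mono (Icc_subset_Icc_right hτ)
  integrable t ht := h.integrable t ⟨ht.1, ht.2.trans hτ⟩
  eq t ht := h.eq t ⟨ht.1, ht.2.trans hτ⟩

theorem IsSolutionOn.congr (h : S.IsSolutionOn x w τ ξ) {w' : ℝ → W} {ξ' : ℝ → X}
    (hw : ∀ t ∈ Icc 0 τ, w' t = w t) (hξ : ∀ t ∈ Icc 0 τ, ξ' t = ξ t) :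
    S.IsSolutionOn x w' τ ξ' := by
  have key : ∀ t ∈ Icc 0 τ, EqOn (fun s => S.T.toFun (t - s).toNNReal (S.f (ξ s) (w s)))
      (fun s => S.T.toFun (t - s).toNNReal (S.f (ξ' s) (w' s))) (uIcc 0 t) := by
    intro t ht s hs
    rw [uIcc_of_le ht.1] at hs
    have hs' : s ∈ Icc 0 τ := ⟨hs.1, hs.2.trans ht.2⟩
    simp only [hw s hs', hξ s hs']
  refine ⟨h.continuousOn.congr hξ, fun t ht => ?_, fun t ht => ?_⟩
  · exact (h.integrable t ht).congr ((key t ht).mono uIoc_subset_uIcc)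
  · rw [hξ t ht, h.eq t ht, intervalIntegral.integral_congr (key t ht)]

theorem IsSolution.isSolutionOn [NormedAddCommGroup W] {b : EReal} (h : S.IsSolution x w b ξ)
    (hτ : (τ : EReal) < b) : S.IsSolutionOn x w τ ξ := by
  have hsub : Icc 0 τ ⊆ timeInterval b := fun t ht =>
    ⟨ht.1, (EReal.coe_le_coe_iff.2 ht.2).trans_lt hτ⟩
  exact ⟨h.continuousOn.mono hsub, fun t ht => h.integrable t (hsub ht),
    fun t ht => h.eq t (hsub ht)⟩

theorem isSolution_top [NormedAddCommGroup W] (h : ∀ τ, 0 ≤ τ → S.IsSolutionOn x w τ ξ) :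
    S.IsSolution x w ⊤ ξ where
  pos := EReal.coe_lt_top 0
  continuousOn t ht := by
    refine ((h (t + 1) (by linarith [ht.1])).continuousOn t ⟨ht.1, by
      linarith⟩).mono_of_mem_nhdsWithin ?_
    have : Iio (t + 1) ∈ 𝓝[timeInterval ⊤] t :=
      mem_nhdsWithin_of_mem_nhds (Iio_mem_nhds (lt_add_one t))
    filter_upwards [this, self_mem_nhdsWithin] with s hs hs'
    exact ⟨hs'.1, (mem_Iio.1 hs).le⟩
  integrable t ht := (h t ht.1).integrable t ⟨ht.1, le_rfl⟩
  eq t ht := (h t ht.1).eq t ⟨ht.1, le_rfl⟩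

theorem _root_.C0Semigroup.toFun_add_apply (T : C0Semigroup X) {s t : ℝ} (hs : 0 ≤ s)
    (ht : 0 ≤ t) (x : X) :
    T.toFun (s + t).toNNReal x = T.toFun s.toNNReal (T.toFun t.toNNReal x) := by
  rw [Real.toNNReal_add hs ht, T.map_add]
  rfl

theorem _root_.ContinuousLinearMap.intervalIntegrable_comp {Y : Type*} [NormedAddCommGroup Y]
    [NormedSpace ℝ Y] (L : X →L[ℝ] Y) {g : ℝ → X} {a b : ℝ}
    (hg : IntervalIntegrable g MeasureTheory.volume a b) :
    IntervalIntegrable (fun s => L (g s)) MeasureTheory.volume a b :=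
  ⟨L.integrable_comp hg.1, L.integrable_comp hg.2⟩

variable [CompleteSpace X]

/-- The semigroup property on the part of the mild solution formula up to time `s`. -/
theorem IsSolutionOn.semigroup_apply (h : S.IsSolutionOn x w τ ξ) {s t : ℝ} (hs : s ∈ Icc 0 τ)
    (ht : 0 ≤ t) :
    IntervalIntegrable (fun r => S.T.toFun (s + t - r).toNNReal (S.f (ξ r) (w r)))
      MeasureTheory.volume 0 s ∧
    S.T.toFun t.toNNReal (ξ s) = S.T.toFun (s + t).toNNReal x +
      ∫ r in (0 : ℝ)..s, S.T.toFun (s + t - r).toNNReal (S.f (ξ r) (w r)) := by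
  have key : EqOn (fun r => S.T.toFun t.toNNReal (S.T.toFun (s - r).toNNReal (S.f (ξ r) (w r))))
      (fun r => S.T.toFun (s + t - r).toNNReal (S.f (ξ r) (w r))) (uIcc 0 s) := by
    intro r hr
    rw [uIcc_of_le hs.1] at hr
    simp only
    rw [← S.T.toFun_add_apply ht (sub_nonneg.2 hr.2)]
    congr 3
    ring
  refine ⟨((S.T.toFun t.toNNReal).intervalIntegrable_comp (h.integrable s hs)).congr
    (key.mono uIoc_subset_uIcc), ?_⟩
  rw [h.eq s hs, map_add, ← S.T.toFun_add_apply ht hs.1, add_comm t s,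
    ← ContinuousLinearMap.intervalIntegral_comp_comm _ (h.integrable s hs),
    intervalIntegral.integral_congr key]

/-- Cut the integral over [0, s + t] at s. By `semigroup_apply`, the first part together with T(s +
t)x equals T(t)ξ(s); the second part is translated to [0, t]. -/
theorem IsSolutionOn.shift {s : ℝ} (h : S.IsSolutionOn x w (s + τ) ξ) (hs : 0 ≤ s) :
    S.IsSolutionOn (ξ s) (fun t => w (s + t)) τ fun t => ξ (s + t) := by
  have hint : ∀ t ∈ Icc 0 τ, IntervalIntegrable
      (fun r => S.T.toFun (s + t - r).toNNReal (S.f (ξ r) (w r))) MeasureTheory.volume s (s + t) := by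
    intro t ht
    refine (h.integrable (s + t) ⟨add_nonneg hs ht.1, by linarith [ht.2]⟩).mono_set ?_
    rw [uIcc_of_le (by linarith [ht.1]), uIcc_of_le (add_nonneg hs ht.1)]
    exact Icc_subset_Icc_left hs
  refine ⟨?_, fun t ht => ?_, fun t ht => ?_⟩
  · refine h.continuousOn.comp (continuous_const.add continuous_id).continuousOn fun t ht => ?_
    exact ⟨add_nonneg hs ht.1, by simpa using ht.2⟩
  · have := (hint t ht).comp_add_left s
    simpa only [sub_self, add_sub_cancel_left, add_sub_add_left_eq_sub] using this
  · have hs' : s ∈ Icc 0 (s + τ) := ⟨hs, by linarith [ht.1, ht.2]⟩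
    obtain ⟨h₁, h₂⟩ := h.semigroup_apply hs' ht.1
    have h₃ := intervalIntegral.integral_comp_add_left (a := 0) (b := t)
      (fun r => S.T.toFun (s + t - r).toNNReal (S.f (ξ r) (w r))) s
    simp only [add_zero, add_sub_add_left_eq_sub] at h₃
    rw [h₂, h₃, add_assoc, intervalIntegral.integral_add_adjacent_intervals h₁ (hint t ht),
      h.eq (s + t) ⟨add_nonneg hs ht.1, by linarith [ht.2]⟩]

/-- Concatenation of mild solutions. -/
theorem IsSolutionOn.concat {s : ℝ} {ζ : ℝ → X} (hs : 0 ≤ s) (h : S.IsSolutionOn x w s ξ)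
    (h' : S.IsSolutionOn (ξ s) (fun t => w (s + t)) τ ζ) (hτ : 0 ≤ τ) :
    S.IsSolutionOn x w (s + τ) fun t => if t ≤ s then ξ t else ζ (t - s) := by
  set η : ℝ → X := fun t => if t ≤ s then ξ t else ζ (t - s) with hη
  have hη₁ : ∀ t ≤ s, η t = ξ t := fun t ht => if_pos ht
  have hη₂ : ∀ t, 0 ≤ t → η (s + t) = ζ t := by
    intro t ht
    rcases ht.eq_or_lt with rfl | ht
    · rw [add_zero, hη₁ s le_rfl, h'.initial hτ]
    · simp only [hη]
      rw [if_neg (by linarith), add_sub_cancel_left]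
  -- Both pieces are restated in terms of η, so that the two integrals have the same integrand and
  -- can be joined at s.
  have h₁ : S.IsSolutionOn x w s η := h.congr (fun _ _ => rfl) fun t ht => hη₁ t ht.2
  have h₂ : S.IsSolutionOn (η s) (fun t => w (s + t)) τ fun t => η (s + t) := by
    rw [hη₁ s le_rfl]
    exact h'.congr (fun _ _ => rfl) fun t ht => hη₂ t ht.1
  have hint : ∀ t ∈ Icc 0 τ, IntervalIntegrable
      (fun r => S.T.toFun (s + t - r).toNNReal (S.f (η r) (w r))) MeasureTheory.volume s (s + t) := by
    intro t ht
    have := (h₂.integrable t ht).comp_add_left (-s)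
    have he : ∀ r, t - (-s + r) = s + t - r := fun r => by ring
    simpa only [sub_neg_eq_add, zero_add, he, add_neg_cancel_left, add_comm t s] using this
  refine ⟨?_, fun t ht => ?_, fun t ht => ?_⟩
  · have hc : ContinuousOn η (Icc s (s + τ)) := by
      have : ContinuousOn (fun t => η (s + (t - s))) (Icc s (s + τ)) :=
        h₂.continuousOn.comp (continuous_id.sub continuous_const).continuousOn fun t ht =>
          ⟨by simpa using ht.1, by simpa [add_comm] using ht.2⟩
      simpa using this
    have := h₁.continuousOn.union_of_isClosed hc isClosed_Icc isClosed_Icc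
    rwa [Icc_union_Icc_eq_Icc hs (by linarith)] at this
  · rcases le_total t s with hts | hts
    · exact h₁.integrable t ⟨ht.1, hts⟩
    · obtain ⟨r, rfl⟩ : ∃ r, t = s + r := ⟨t - s, by ring⟩
      have hr : r ∈ Icc 0 τ := ⟨by linarith, by linarith [ht.2]⟩
      exact (h₁.semigroup_apply ⟨hs, le_rfl⟩ hr.1).1.trans (hint r hr)
  · rcases le_total t s with hts | hts
    · exact h₁.eq t ⟨ht.1, hts⟩
    · obtain ⟨r, rfl⟩ : ∃ r, t = s + r := ⟨t - s, by ring⟩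
      have hr : r ∈ Icc 0 τ := ⟨by linarith, by linarith [ht.2]⟩
      obtain ⟨h₃, h₄⟩ := h₁.semigroup_apply ⟨hs, le_rfl⟩ hr.1
      have h₅ := intervalIntegral.integral_comp_add_left (a := 0) (b := r)
        (fun q => S.T.toFun (s + r - q).toNNReal (S.f (η q) (w q))) s
      simp only [add_zero, add_sub_add_left_eq_sub] at h₅
      rw [h₂.eq r hr, h₄, h₅, add_assoc,
        intervalIntegral.integral_add_adjacent_intervals h₃ (hint r hr)]

/-- Under forward completeness, mild solutions on compact intervals extend to `[0, ∞)`. -/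
theorem IsSolutionOn.exists_extension [NormedAddCommGroup W] (hfc : S.ForwardComplete)
    (hτ : 0 ≤ τ) (h : S.IsSolutionOn x w τ ξ) (hw : IsPCb w) :
    ∃ η, S.IsSolution x w ⊤ η ∧ ∀ t ≤ τ, η t = ξ t := by
  obtain ⟨ζ, hζ⟩ := hfc (ξ τ) _ (hw.shift hτ)
  refine ⟨fun t => if t ≤ τ then ξ t else ζ (t - τ), isSolution_top fun t ht => ?_,
    fun t ht => if_pos ht⟩
  exact (IsSolutionOn.concat hτ h (hζ.isSolutionOn (EReal.coe_lt_top t)) ht).mono (by linarith)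

end SemilinearSystem

namespace CoupledSystem

variable {X₁ X₂ U : Type*} [NormedAddCommGroup X₁] [NormedSpace ℝ X₁] [CompleteSpace X₁]
  [NormedAddCommGroup X₂] [NormedSpace ℝ X₂] [CompleteSpace X₂]
  {S : CoupledSystem X₁ X₂ U} {x : WithLp 1 (X₁ × X₂)} {u : ℝ → U} {τ : ℝ}
  {ξ : ℝ → WithLp 1 (X₁ × X₂)}

/-- Projection is bounded and linear, so it commutes with the integral, and it intertwines the
diagonal semigroup with its component. The other component turns into an input. -/
theorem isSolutionOn_fst (h : S.interconnection.IsSolutionOn x u τ ξ) :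
    S.subsystem₁.IsSolutionOn x.fst (fun t => ((ξ t).snd, u t)) τ fun t => (ξ t).fst where
  continuousOn := (WithLp.continuous_fst 1 X₁ X₂).comp_continuousOn h.continuousOn
  integrable t ht := (WithLp.fstL 1 ℝ X₁ X₂).intervalIntegrable_comp (h.integrable t ht)
  eq t ht := by
    have := congrArg (WithLp.fstL 1 ℝ X₁ X₂) (h.eq t ht)
    rw [map_add, ← ContinuousLinearMap.intervalIntegral_comp_comm _ (h.integrable t ht)] at this
    exact this

theorem isSolutionOn_snd (h : S.interconnection.IsSolutionOn x u τ ξ) :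
    S.subsystem₂.IsSolutionOn x.snd (fun t => ((ξ t).fst, u t)) τ fun t => (ξ t).snd where
  continuousOn := (WithLp.continuous_snd 1 X₁ X₂).comp_continuousOn h.continuousOn
  integrable t ht := (WithLp.sndL 1 ℝ X₁ X₂).intervalIntegrable_comp (h.integrable t ht)
  eq t ht := by
    have := congrArg (WithLp.sndL 1 ℝ X₁ X₂) (h.eq t ht)
    rw [map_add, ← ContinuousLinearMap.intervalIntegral_comp_comm _ (h.integrable t ht)] at this
    exact this

end CoupledSystem

/-! ### Comparison along the small-gain path -/

theorem eventually_le_of_decay {a A : ℝ → ℝ} {t κ : ℝ}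
    (ha : ∀ᶠ z in 𝓝[>] t, a z ≤ a t - κ * (z - t))
    (hA : ∀ᶠ z in 𝓝[>] t, A t - A z ≤ κ * (z - t)) (h : a t ≤ A t) :
    ∀ᶠ z in 𝓝[>] t, a z ≤ A z := by
  filter_upwards [ha, hA] with z hz hz'
  linarith

/-- The maximum may have a kink where r t = s, so a one-sided bound replaces its derivative. Below
the level s it is constant; otherwise it loses at most what r loses. -/
theorem eventually_max_sub_le {r : ℝ → ℝ} {r' s t κ : ℝ} (hr : HasDerivAt r r' t)
    (hanti : Antitone r) (hκ₀ : 0 ≤ κ) (hκ : s ≤ r t → -r' < κ) :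
    ∀ᶠ z in 𝓝[>] t, max (r t) s - max (r z) s ≤ κ * (z - t) := by
  rcases lt_or_ge (r t) s with hlt | hge
  · filter_upwards [self_mem_nhdsWithin] with z hz
    have hz : t < z := hz
    rw [max_eq_right hlt.le, max_eq_right ((hanti hz.le).trans hlt.le), sub_self]
    exact mul_nonneg hκ₀ (sub_nonneg.2 hz.le)
  · have hs := (hasDerivAt_iff_tendsto_slope.1 hr).mono_left
      (nhdsWithin_mono t fun z (hz : t < z) => hz.ne')
    have hlt : -κ < r' := by linarith [hκ hge]
    filter_upwards [hs.eventually (lt_mem_nhds hlt), self_mem_nhdsWithin] with z hz htz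
    have htz : 0 < z - t := sub_pos.2 htz
    rw [slope_def_field, lt_div_iff₀ htz] at hz
    have := le_max_left (r z) s
    rw [max_eq_left hge]
    linarith

/-- One component of a trajectory cannot cross the shrinking boundary `σ₁ (max (r t) s)`. -/
theorem eventually_le_path {σ₁ σ₂ χ α : ℝ → ℝ} (hσ₁ : ClassKInf σ₁) (hσ₂ : ClassKInf σ₂)
    (hsum : ∀ r, 0 ≤ r → σ₁ r + σ₂ r = r) (hgain : ∀ r, 0 < r → χ (σ₂ r) < σ₁ r)
    (hχ : MonotoneOn χ (Ici 0)) {a b r ρ : ℝ → ℝ} {s c t : ℝ}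
    (hr : HasDerivAt r (-ρ (r t)) t) (hanti : Antitone r)
    (hρ : ∀ r, 0 < r → 0 < ρ r ∧ ρ r < α (σ₁ r)) (hs : 0 < s) (hc : c < σ₁ s)
    (hac : ContinuousWithinAt a (Ioi t) t) (hb : 0 ≤ b t)
    (hD : max (χ (b t)) c < a t → ∀ κ < α (a t), ∀ᶠ z in 𝓝[>] t, a z ≤ a t - κ * (z - t))
    (hat : a t ≤ σ₁ (max (r t) s)) (hbt : b t ≤ σ₂ (max (r t) s)) :
    ∀ᶠ z in 𝓝[>] t, a z ≤ σ₁ (max (r z) s) := by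
  have hmpos : ∀ z, 0 < max (r z) s := fun z => lt_max_of_lt_right hs
  have hmc : ContinuousAt (fun z => σ₁ (max (r z) s)) t :=
    ContinuousAt.comp (f := fun z => max (r z) s)
      (hσ₁.continuousOn.continuousAt (Ici_mem_nhds (hmpos t)))
      (hr.continuousAt.tendsto.max tendsto_const_nhds)
  -- Strictly inside the box continuity suffices; only on the face must decay rates be compared.
  rcases hat.lt_or_eq with hlt | heq
  · filter_upwards [hac.tendsto.eventually_lt (hmc.tendsto.mono_left nhdsWithin_le_nhds) hlt]
      with z hz using hz.le
  · have h₁ : max (χ (b t)) c < a t := by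
      refine max_lt ?_ ?_
      · rw [heq]
        exact (hχ hb (hb.trans hbt) hbt).trans_lt (hgain _ (hmpos t))
      · rw [heq]
        exact hc.trans_le (hσ₁.mono hs.le (le_max_right _ _))
    obtain ⟨hρ₀, hρ₁⟩ := hρ _ (hmpos t)
    -- The rate κ lies strictly between the speed of the boundary and the decay rate of a, leaving
    -- room for the passage to difference quotients on both sides.
    obtain ⟨κ, hκ₁, hκ₂⟩ := exists_between hρ₁
    rw [← heq] at hκ₂
    refine eventually_le_of_decay (hD h₁ κ hκ₂) ?_ hat
    have h₂ := eventually_max_sub_le (s := s) hr hanti (hρ₀.trans hκ₁).le fun h => by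
      rwa [neg_neg, ← max_eq_left h]
    -- Since σ₁ = id - σ₂ and σ₂ increases, σ₁ drops by no more than its argument.
    filter_upwards [h₂, self_mem_nhdsWithin] with z hz htz
    have h₃ : max (r z) s ≤ max (r t) s := max_le_max_right s (hanti (le_of_lt htz))
    have h₄ := hσ₂.mono (hmpos z).le h₃
    have h₅ := hsum _ (hmpos z).le
    have h₆ := hsum _ (hmpos t).le
    linarith

/-- Scalar version of the small-gain theorem. -/
theorem exists_classKL_bound {χ₁₂ χ₂₁ α₁ α₂ : ℝ → ℝ}
    (hχ₁₂ : ClassKInf χ₁₂ ∨ ∀ r, 0 ≤ r → χ₁₂ r = 0)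
    (hχ₂₁ : ClassKInf χ₂₁ ∨ ∀ r, 0 ≤ r → χ₂₁ r = 0)
    (hα₁ : ClassPD α₁) (hα₂ : ClassPD α₂) (hsg : ∀ r, 0 < r → χ₁₂ (χ₂₁ r) < r) :
    ∃ (β : ℝ → ℝ → ℝ) (σ₁ σ₂ : ℝ → ℝ), ClassKL β ∧ ClassKInf σ₁ ∧ ClassKInf σ₂ ∧
      ∀ (a b : ℝ → ℝ) (τ c₁ c₂ R s : ℝ), ContinuousOn a (Icc 0 τ) → ContinuousOn b (Icc 0 τ) →
        (∀ t, 0 ≤ a t) → (∀ t, 0 ≤ b t) →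
        (∀ t ∈ Ico 0 τ, max (χ₁₂ (b t)) c₁ < a t → ∀ κ < α₁ (a t),
          ∀ᶠ z in 𝓝[>] t, a z ≤ a t - κ * (z - t)) →
        (∀ t ∈ Ico 0 τ, max (χ₂₁ (a t)) c₂ < b t → ∀ κ < α₂ (b t),
          ∀ᶠ z in 𝓝[>] t, b z ≤ b t - κ * (z - t)) →
        0 ≤ R → 0 ≤ s → a 0 ≤ σ₁ R → b 0 ≤ σ₂ R → c₁ ≤ σ₁ s → c₂ ≤ σ₂ s →
        ∀ t ∈ Icc 0 τ, a t ≤ σ₁ (max (β R t) s) ∧ b t ≤ σ₂ (max (β R t) s) := by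
  have hmono : ∀ {χ : ℝ → ℝ}, (ClassKInf χ ∨ ∀ r, 0 ≤ r → χ r = 0) → MonotoneOn χ (Ici 0) := by
    rintro χ (h | h)
    · exact h.strictMonoOn.monotoneOn
    · intro x hx y hy _
      rw [h x hx, h y hy]
  obtain ⟨σ₁, σ₂, hσ₁, hσ₂, hsum, hgain⟩ := exists_smallGain_path hχ₁₂ hχ₂₁ hsg
  -- The halves make ρ strictly smaller than both decay rates; the minimum with r is what
  -- `exists_classKL_flow` requires.
  set ρ : ℝ → ℝ := fun r => min r (min (α₁ (σ₁ r) / 2) (α₂ (σ₂ r) / 2)) with hρ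
  have hα₁' : ∀ r, 0 < r → 0 < α₁ (σ₁ r) := fun r hr => hα₁.pos _ (hσ₁.pos hr)
  have hα₂' : ∀ r, 0 < r → 0 < α₂ (σ₂ r) := fun r hr => hα₂.pos _ (hσ₂.pos hr)
  have hρpos : ∀ r, 0 < r → 0 < ρ r := fun r hr =>
    lt_min hr (lt_min (half_pos (hα₁' r hr)) (half_pos (hα₂' r hr)))
  have hρ₁ : ∀ r, 0 < r → 0 < ρ r ∧ ρ r < α₁ (σ₁ r) := fun r hr =>
    ⟨hρpos r hr, ((min_le_right _ _).trans (min_le_left _ _)).trans_lt (half_lt_self (hα₁' r hr))⟩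
  have hρ₂ : ∀ r, 0 < r → 0 < ρ r ∧ ρ r < α₂ (σ₂ r) := fun r hr =>
    ⟨hρpos r hr, ((min_le_right _ _).trans (min_le_right _ _)).trans_lt (half_lt_self (hα₂' r hr))⟩
  have hρc : ContinuousOn ρ (Ioi 0) := by
    have h₁ := hα₁.continuousOn.comp hσ₁.continuousOn hσ₁.mapsTo
    have h₂ := hα₂.continuousOn.comp hσ₂.continuousOn hσ₂.mapsTo
    exact (continuousOn_id.inf ((h₁.div_const 2).inf (h₂.div_const 2))).mono Ioi_subset_Ici_self
  obtain ⟨β, hβ, hβ'⟩ := exists_classKL_flow hρc hρpos fun r _ => min_le_left _ _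
  refine ⟨β, σ₁, σ₂, hβ, hσ₁, hσ₂, ?_⟩
  intro a b τ c₁ c₂ R s hac hbc ha hb hDa hDb hR hs ha0 hb0 hc₁ hc₂
  -- Enlarging R and s by ε makes the starting value of the flow positive and the input thresholds
  -- strict. The limit ε → 0 is taken at the end.
  have key : ∀ ε, 0 < ε → ∀ t ∈ Icc 0 τ, a t ≤ σ₁ (max (β (R + ε) t) (s + ε)) ∧
      b t ≤ σ₂ (max (β (R + ε) t) (s + ε)) := by
    intro ε hε
    have hRε : 0 < R + ε := by linarith
    have hsε : 0 < s + ε := by linarith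
    obtain ⟨hβ₀, hβd⟩ := hβ' _ hRε
    have hanti : Antitone (β (R + ε)) := antitone_of_deriv_nonpos
      (fun t => (hβd t).2.differentiableAt) fun t => by
        rw [(hβd t).2.deriv]
        exact neg_nonpos.2 (hρpos _ (hβd t).1).le
    have hmc : Continuous fun t => max (β (R + ε) t) (s + ε) :=
      (continuous_iff_continuousAt.2 fun t => (hβd t).2.continuousAt).max continuous_const
    have hmpos : ∀ t, max (β (R + ε) t) (s + ε) ∈ Ici (0 : ℝ) := fun t =>
      (lt_max_of_lt_right hsε).le
    have hcl : ∀ {f σ : ℝ → ℝ}, ContinuousOn f (Icc 0 τ) → ClassKInf σ →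
        IsClosed {t ∈ Icc 0 τ | f t ≤ σ (max (β (R + ε) t) (s + ε))} := fun hf hσ =>
      isClosed_Icc.isClosed_le hf (hσ.continuousOn.comp_continuous hmc hmpos).continuousOn
    have hinit : ∀ {σ : ℝ → ℝ}, ClassKInf σ → σ R ≤ σ (max (β (R + ε) 0) (s + ε)) := by
      intro σ hσ
      rw [hβ₀]
      exact hσ.mono hR ((le_add_of_nonneg_right hε.le).trans (le_max_left _ _))
    have hlt : ∀ {σ : ℝ → ℝ}, ClassKInf σ → σ s < σ (s + ε) := fun hσ =>
      hσ.strictMonoOn hs hsε.le (lt_add_of_pos_right s hε)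
    have hIoi : ∀ {f : ℝ → ℝ} {t}, ContinuousOn f (Icc 0 τ) → t ∈ Ico 0 τ →
        ContinuousWithinAt f (Ioi t) t := fun hf ht =>
      (hf _ (Ico_subset_Icc_self ht)).mono_of_mem_nhdsWithin
        (Icc_mem_nhdsGT_of_mem ht)
    -- Continuous induction: the set of times spent in the box is closed, contains 0 and extends to
    -- the right of each of its points before τ.
    refine IsClosed.Icc_subset_of_forall_exists_gt
      (s := {t | a t ≤ σ₁ (max (β (R + ε) t) (s + ε)) ∧ b t ≤ σ₂ (max (β (R + ε) t) (s + ε))})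
      ?_ ⟨ha0.trans (hinit hσ₁), hb0.trans (hinit hσ₂)⟩ ?_
    · convert (hcl hac hσ₁).inter (hcl hbc hσ₂) using 1
      ext t
      exact ⟨fun h => ⟨⟨h.2, h.1.1⟩, h.2, h.1.2⟩, fun h => ⟨⟨h.1.2, h.2.2⟩, h.1.1⟩⟩
    · rintro t ⟨⟨hat, hbt⟩, ht⟩ y hy
      have h₁ := eventually_le_path hσ₁ hσ₂ hsum (fun r hr => (hgain r hr).1) (hmono hχ₁₂)
        (hβd t).2 hanti hρ₁ hsε (hc₁.trans_lt (hlt hσ₁)) (hIoi hac ht) (hb t)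
        (hDa t ht) hat hbt
      have h₂ := eventually_le_path hσ₂ hσ₁ (fun r hr => (add_comm _ _).trans (hsum r hr))
        (fun r hr => (hgain r hr).2) (hmono hχ₂₁)
        (hβd t).2 hanti hρ₂ hsε (hc₂.trans_lt (hlt hσ₂)) (hIoi hbc ht) (ha t)
        (hDb t ht) hbt hat
      obtain ⟨z, ⟨hz₁, hz₂⟩, hz⟩ := ((h₁.and h₂).and (Ioc_mem_nhdsGT hy)).exists
      exact ⟨z, ⟨hz₁, hz₂⟩, hz⟩
  intro t ht
  have hlim : ∀ {σ : ℝ → ℝ}, ClassKInf σ →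
      Tendsto (fun ε => σ (max (β (R + ε) t) (s + ε))) (𝓝[>] 0) (𝓝 (σ (max (β R t) s))) := by
    intro σ hσ
    have h₁ : ∀ c : ℝ, Tendsto (fun ε => c + ε) (𝓝[>] 0) (𝓝 c) := fun c => by
      have := (continuous_const_add c).tendsto 0
      rw [add_zero] at this
      exact this.mono_left nhdsWithin_le_nhds
    have h₂ : Tendsto (fun ε => β (R + ε) t) (𝓝[>] 0) (𝓝 (β R t)) := by
      refine ((hβ.classK t ht.1).continuousOn R hR).tendsto.comp
        (tendsto_nhdsWithin_iff.2 ⟨h₁ R, ?_⟩)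
      filter_upwards [self_mem_nhdsWithin] with ε hε
      exact add_nonneg hR (le_of_lt hε)
    refine (hσ.continuousOn _ (mem_Ici.2 (hs.trans (le_max_right _ _)))).tendsto.comp
      (tendsto_nhdsWithin_iff.2 ⟨h₂.max (h₁ s), ?_⟩)
    filter_upwards [self_mem_nhdsWithin] with ε hε
    exact (add_nonneg hs (le_of_lt hε)).trans (le_max_right _ _)
  exact ⟨ge_of_tendsto (hlim hσ₁) (by
      filter_upwards [self_mem_nhdsWithin] with ε hε using (key ε hε t ht).1),
    ge_of_tendsto (hlim hσ₂) (by
      filter_upwards [self_mem_nhdsWithin] with ε hε using (key ε hε t ht).2)⟩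

/-! ### Lyapunov functions along trajectories -/

/-- A bound on Lie derivatives at the initial time, for continuous and bounded inputs on
`[0, ∞)`, holds along trajectories on compact intervals. -/
theorem SemilinearSystem.IsSolutionOn.eventually_decay {X Y U : Type*}
    [NormedAddCommGroup X] [NormedSpace ℝ X] [CompleteSpace X] [NormedAddCommGroup Y]
    [NormedAddCommGroup U] {S : SemilinearSystem X (Y × U)} (hfc : S.ForwardComplete)
    {V : X → ℝ} {V' : Y → ℝ} {χ χu α : ℝ → ℝ} (hχu : ClassK χu)
    (hdecay : ∀ (x : X) (v : ℝ → Y) (u : ℝ → U) (ξ : ℝ → X), IsPCb v → IsPCb u →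
      S.IsSolution x (fun t => (v t, u t)) ⊤ ξ →
      max (χ (V' (v 0))) (χu (inputNorm u)) < V x →
      lieDerivative V ξ ≤ ((-α (V x) : ℝ) : EReal))
    {x : X} {v : ℝ → Y} {u : ℝ → U} {τ : ℝ} {ξ : ℝ → X}
    (h : S.IsSolutionOn x (fun t => (v t, u t)) τ ξ) (hv : ContinuousOn v (Icc 0 τ))
    (hu : IsPCb u) {t : ℝ} (ht : t ∈ Ico 0 τ)
    (hgt : max (χ (V' (v t))) (χu (inputNorm u)) < V (ξ t)) {κ : ℝ} (hκ : κ < α (V (ξ t))) :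
    ∀ᶠ z in 𝓝[>] t, V (ξ z) ≤ V (ξ t) - κ * (z - t) := by
  have hε : 0 < τ - t := sub_pos.2 ht.2
  -- The input restarted at time t and frozen at its value at time τ. Clamping at both ends makes it
  -- continuous and bounded on ℝ, hence admissible.
  set v' : ℝ → Y := fun s => v (t + max 0 (min s (τ - t))) with hv'
  have hmem : ∀ s, t + max 0 (min s (τ - t)) ∈ Icc 0 τ := fun s =>
    ⟨add_nonneg ht.1 (le_max_left _ _), by
      have : max 0 (min s (τ - t)) ≤ τ - t := max_le hε.le (min_le_right _ _)
      linarith⟩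
  have hv'c : IsPCb v' := by
    refine .of_continuous (hv.comp_continuous (by fun_prop) hmem) ?_
    obtain ⟨C, hC⟩ := (isCompact_Icc.image_of_continuousOn hv).isBounded.exists_norm_le
    exact ⟨C, fun s => hC _ ⟨_, hmem s, rfl⟩⟩
  have hu' : IsPCb fun s => u (t + s) := hu.shift ht.1
  have hsol : S.IsSolutionOn (ξ t) (fun s => (v' s, u (t + s))) (τ - t) fun s => ξ (t + s) := by
    refine (IsSolutionOn.shift (τ := τ - t) (by simpa using h) ht.1).congr (fun s hs => ?_)
      fun _ _ => rfl
    simp only [hv', min_eq_left hs.2, max_eq_right hs.1]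
  obtain ⟨η, hη, hηξ⟩ := hsol.exists_extension hfc hε.le (hv'c.prodMk hu')
  have hv'0 : v' 0 = v t := by simp [hv', hε.le]
  -- The extension η starts at ξ t and follows ξ up to time τ, and shifting does not increase the
  -- norm of u, so the hypothesis at time 0 applies to η.
  have hL := hdecay (ξ t) v' _ η hv'c hu' hη (by
    rw [hv'0]
    refine lt_of_le_of_lt (max_le_max_left _ ?_) hgt
    exact hχu.mono (inputNorm_nonneg _) (hu.inputNorm_shift_le ht.1))
  have hlt : lieDerivative V η < ((-κ : ℝ) : EReal) :=
    hL.trans_lt (EReal.coe_lt_coe_iff.2 (neg_lt_neg hκ))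
  have hev := Filter.eventually_lt_of_limsup_lt hlt
  have htend : Tendsto (fun z => z - t) (𝓝[>] t) (𝓝[>] 0) := by
    refine tendsto_nhdsWithin_iff.2 ⟨?_, ?_⟩
    · have := (continuous_sub_right t).tendsto t
      rw [sub_self] at this
      exact this.mono_left nhdsWithin_le_nhds
    · filter_upwards [self_mem_nhdsWithin] with z hz using sub_pos.2 (mem_Ioi.1 hz)
  filter_upwards [htend.eventually hev, self_mem_nhdsWithin,
    mem_nhdsWithin_of_mem_nhds (Iio_mem_nhds ht.2)] with z hz htz hzτ
  have htz : 0 < z - t := sub_pos.2 htz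
  rw [EReal.coe_lt_coe_iff, div_lt_iff₀ htz, hηξ _ hε.le,
    hηξ _ (sub_le_sub_right (le_of_lt hzτ) t), add_zero, add_sub_cancel] at hz
  linarith

/-- The `𝒦ℒ`-estimate holds along every solution, on its whole domain. -/
theorem CoupledSystem.exists_iss_estimate {X₁ X₂ U : Type*}
    [NormedAddCommGroup X₁] [NormedSpace ℝ X₁] [CompleteSpace X₁]
    [NormedAddCommGroup X₂] [NormedSpace ℝ X₂] [CompleteSpace X₂] [NormedAddCommGroup U]
    (S : CoupledSystem X₁ X₂ U)
    (hfc₁ : S.subsystem₁.ForwardComplete) (hfc₂ : S.subsystem₂.ForwardComplete)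
    {V₁ : X₁ → ℝ} {V₂ : X₂ → ℝ} (hV₁ : Continuous V₁) (hV₂ : Continuous V₂)
    {ψ₁₁ ψ₁₂ ψ₂₁ ψ₂₂ : ℝ → ℝ}
    (hψ₁₁ : ClassKInf ψ₁₁) (hψ₁₂ : ClassKInf ψ₁₂) (hψ₂₁ : ClassKInf ψ₂₁) (hψ₂₂ : ClassKInf ψ₂₂)
    (hcoercive₁ : ∀ x, ψ₁₁ ‖x‖ ≤ V₁ x ∧ V₁ x ≤ ψ₁₂ ‖x‖)
    (hcoercive₂ : ∀ x, ψ₂₁ ‖x‖ ≤ V₂ x ∧ V₂ x ≤ ψ₂₂ ‖x‖)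
    {χ₁₂ χ₂₁ χ₁u χ₂u α₁ α₂ : ℝ → ℝ}
    (hχ₁₂ : ClassKInf χ₁₂ ∨ ∀ r, 0 ≤ r → χ₁₂ r = 0)
    (hχ₂₁ : ClassKInf χ₂₁ ∨ ∀ r, 0 ≤ r → χ₂₁ r = 0)
    (hχ₁u : ClassK χ₁u) (hχ₂u : ClassK χ₂u) (hα₁ : ClassPD α₁) (hα₂ : ClassPD α₂)
    (hdecay₁ : ∀ (x₁ : X₁) (x₂ : ℝ → X₂) (u : ℝ → U) (ξ : ℝ → X₁), IsPCb x₂ → IsPCb u →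
      S.subsystem₁.IsSolution x₁ (fun t => (x₂ t, u t)) ⊤ ξ →
      max (χ₁₂ (V₂ (x₂ 0))) (χ₁u (inputNorm u)) < V₁ x₁ →
      lieDerivative V₁ ξ ≤ ((-α₁ (V₁ x₁) : ℝ) : EReal))
    (hdecay₂ : ∀ (x₂ : X₂) (x₁ : ℝ → X₁) (u : ℝ → U) (ξ : ℝ → X₂), IsPCb x₁ → IsPCb u →
      S.subsystem₂.IsSolution x₂ (fun t => (x₁ t, u t)) ⊤ ξ →
      max (χ₂₁ (V₁ (x₁ 0))) (χ₂u (inputNorm u)) < V₂ x₂ →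
      lieDerivative V₂ ξ ≤ ((-α₂ (V₂ x₂) : ℝ) : EReal))
    (hsg : ∀ r, 0 < r → χ₁₂ (χ₂₁ r) < r) :
    ∃ (β : ℝ → ℝ → ℝ) (γ : ℝ → ℝ), ClassKL β ∧ ClassKInf γ ∧
      ∀ (x : WithLp 1 (X₁ × X₂)) (u : ℝ → U) (b : EReal) (ξ : ℝ → WithLp 1 (X₁ × X₂)),
        IsPCb u → S.interconnection.IsSolution x u b ξ →
          ∀ t ∈ timeInterval b, ‖ξ t‖ ≤ β ‖x‖ t + γ (inputNorm u) := by
  obtain ⟨β, σ₁, σ₂, hβ, hσ₁, hσ₂, hest⟩ := exists_classKL_bound hχ₁₂ hχ₂₁ hα₁ hα₂ hsg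
  obtain ⟨π₁, hπ₁, hσπ₁, -⟩ := hσ₁.exists_inverse
  obtain ⟨π₂, hπ₂, hσπ₂, -⟩ := hσ₂.exists_inverse
  obtain ⟨δ₁, hδ₁, -, hδψ₁⟩ := hψ₁₁.exists_inverse
  obtain ⟨δ₂, hδ₂, -, hδψ₂⟩ := hψ₂₁.exists_inverse
  have hω := (hδ₁.comp hσ₁).add_classK (hδ₂.comp hσ₂).toClassK
  have hθ := (hπ₁.comp hψ₁₂).add_classK (hπ₂.comp hψ₂₂).toClassK
  have hς := (ClassKInf.id.add_classK (hπ₁.toClassK.comp hχ₁u)).add_classK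
    (hπ₂.toClassK.comp hχ₂u)
  -- With πᵢ = σᵢ⁻¹ and δ₁, δ₂ the inverses of ψ₁₁, ψ₂₁: θ turns the initial norm, and ς the input
  -- norm, into a path parameter, while ω turns a path parameter into a bound on the norm. The
  -- summand r in ς guarantees unboundedness, as χ₁u and χ₂u are only of class 𝒦.
  set ω : ℝ → ℝ := fun r => δ₁ (σ₁ r) + δ₂ (σ₂ r)
  set θ : ℝ → ℝ := fun r => π₁ (ψ₁₂ r) + π₂ (ψ₂₂ r)
  set ς : ℝ → ℝ := fun r => r + π₁ (χ₁u r) + π₂ (χ₂u r) with hς_def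
  refine ⟨_, _, hβ.comp hω.toClassK hθ.toClassK, hω.comp hς, ?_⟩
  intro x u b ξ hu hξ τ hτ
  have h := hξ.isSolutionOn hτ.2
  have h₁ := isSolutionOn_fst h
  have h₂ := isSolutionOn_snd h
  have hV₁0 : ∀ x, 0 ≤ V₁ x := fun x => (hψ₁₁.nonneg (norm_nonneg x)).trans (hcoercive₁ x).1
  have hV₂0 : ∀ x, 0 ≤ V₂ x := fun x => (hψ₂₁.nonneg (norm_nonneg x)).trans (hcoercive₂ x).1
  have hx := norm_nonneg x
  have hx' := WithLp.prod_norm_eq_of_L1 x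
  have hx₁ : ‖x.fst‖ ≤ ‖x‖ := by rw [hx']; linarith [norm_nonneg x.snd]
  have hx₂ : ‖x.snd‖ ≤ ‖x‖ := by rw [hx']; linarith [norm_nonneg x.fst]
  have hn := inputNorm_nonneg u
  have hinit₁ : V₁ (ξ 0).fst ≤ σ₁ (θ ‖x‖) := by
    rw [h.initial hτ.1]
    calc V₁ x.fst ≤ ψ₁₂ ‖x‖ := (hcoercive₁ _).2.trans (hψ₁₂.mono (norm_nonneg _) hx₁)
      _ = σ₁ (π₁ (ψ₁₂ ‖x‖)) := (hσπ₁ _ (hψ₁₂.nonneg hx)).symm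
      _ ≤ σ₁ (θ ‖x‖) := hσ₁.mono (hπ₁.nonneg (hψ₁₂.nonneg hx))
          (le_add_of_nonneg_right (hπ₂.nonneg (hψ₂₂.nonneg hx)))
  have hinit₂ : V₂ (ξ 0).snd ≤ σ₂ (θ ‖x‖) := by
    rw [h.initial hτ.1]
    calc V₂ x.snd ≤ ψ₂₂ ‖x‖ := (hcoercive₂ _).2.trans (hψ₂₂.mono (norm_nonneg _) hx₂)
      _ = σ₂ (π₂ (ψ₂₂ ‖x‖)) := (hσπ₂ _ (hψ₂₂.nonneg hx)).symm
      _ ≤ σ₂ (θ ‖x‖) := hσ₂.mono (hπ₂.nonneg (hψ₂₂.nonneg hx))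
          (le_add_of_nonneg_left (hπ₁.nonneg (hψ₁₂.nonneg hx)))
  have hπ₁n := hπ₁.nonneg (hχ₁u.nonneg hn)
  have hπ₂n := hπ₂.nonneg (hχ₂u.nonneg hn)
  have hgain₁ : χ₁u (inputNorm u) ≤ σ₁ (ς (inputNorm u)) := by
    rw [← hσπ₁ _ (hχ₁u.nonneg hn)]
    exact hσ₁.mono hπ₁n (by simp only [hς_def]; linarith)
  have hgain₂ : χ₂u (inputNorm u) ≤ σ₂ (ς (inputNorm u)) := by
    rw [← hσπ₂ _ (hχ₂u.nonneg hn)]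
    exact hσ₂.mono hπ₂n (by simp only [hς_def]; linarith)
  obtain ⟨he₁, he₂⟩ := hest (fun t => V₁ (ξ t).fst) (fun t => V₂ (ξ t).snd) τ
    (χ₁u (inputNorm u)) (χ₂u (inputNorm u)) (θ ‖x‖) (ς (inputNorm u))
    (hV₁.comp_continuousOn h₁.continuousOn) (hV₂.comp_continuousOn h₂.continuousOn)
    (fun t => hV₁0 _) (fun t => hV₂0 _)
    (fun t ht hgt κ hκ => h₁.eventually_decay hfc₁ hχ₁u hdecay₁ h₂.continuousOn hu ht hgt hκ)
    (fun t ht hgt κ hκ => h₂.eventually_decay hfc₂ hχ₂u hdecay₂ h₁.continuousOn hu ht hgt hκ)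
    (hθ.nonneg hx) (hς.nonneg hn) hinit₁ hinit₂ hgain₁ hgain₂ τ ⟨hτ.1, le_rfl⟩
  have hn₁ : ‖(ξ τ).fst‖ ≤ δ₁ (σ₁ (max (β (θ ‖x‖) τ) (ς (inputNorm u)))) := by
    rw [← hδψ₁ _ (norm_nonneg _)]
    exact hδ₁.mono (hψ₁₁.nonneg (norm_nonneg _)) ((hcoercive₁ _).1.trans he₁)
  have hn₂ : ‖(ξ τ).snd‖ ≤ δ₂ (σ₂ (max (β (θ ‖x‖) τ) (ς (inputNorm u)))) := by
    rw [← hδψ₂ _ (norm_nonneg _)]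
    exact hδ₂.mono (hψ₂₁.nonneg (norm_nonneg _)) ((hcoercive₂ _).1.trans he₂)
  rw [WithLp.prod_norm_eq_of_L1]
  exact (add_le_add hn₁ hn₂).trans (hω.le_add_of_max
    ((hβ.classK τ hτ.1).nonneg (hθ.nonneg hx)) (hς.nonneg hn))

/-! ### Input-to-state stability of the interconnection -/

theorem mainTheorem1 {X₁ X₂ U : Type*}
    [NormedAddCommGroup X₁] [NormedSpace ℝ X₁] [CompleteSpace X₁]
    [NormedAddCommGroup X₂] [NormedSpace ℝ X₂] [CompleteSpace X₂]
    [NormedAddCommGroup U] [NormedSpace ℝ U] [CompleteSpace U]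
    (S : CoupledSystem X₁ X₂ U)
    -- `f` is continuous on `X × U`
    (hf : Continuous fun p : WithLp 1 (X₁ × X₂) × U => S.interconnection.f p.1 p.2)
    -- `fᵢ` is Lipschitz continuous with respect to `xᵢ` on bounded subsets
    (hf₁ : ∀ r : ℝ, ∃ L : ℝ, ∀ (x y : X₁) (z : X₂) (u : U),
      ‖x‖ ≤ r → ‖y‖ ≤ r → ‖z‖ ≤ r → ‖u‖ ≤ r → ‖S.f₁ x z u - S.f₁ y z u‖ ≤ L * ‖x - y‖)
    (hf₂ : ∀ r : ℝ, ∃ L : ℝ, ∀ (x y : X₂) (z : X₁) (u : U),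
      ‖x‖ ≤ r → ‖y‖ ≤ r → ‖z‖ ≤ r → ‖u‖ ≤ r → ‖S.f₂ z x u - S.f₂ z y u‖ ≤ L * ‖x - y‖)
    -- forward completeness of the subsystems
    (hfc₁ : S.subsystem₁.ForwardComplete) (hfc₂ : S.subsystem₂.ForwardComplete)
    -- well-posedness and boundedness-implies-continuation property of the interconnection
    (hwp : S.interconnection.WellPosed) (hbic : S.interconnection.BIC)
    -- ISS Lyapunov functions of the subsystems
    (V₁ : X₁ → ℝ) (V₂ : X₂ → ℝ) (hV₁ : Continuous V₁) (hV₂ : Continuous V₂)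
    (ψ₁₁ ψ₁₂ ψ₂₁ ψ₂₂ : ℝ → ℝ)
    (hψ₁₁ : ClassKInf ψ₁₁) (hψ₁₂ : ClassKInf ψ₁₂) (hψ₂₁ : ClassKInf ψ₂₁) (hψ₂₂ : ClassKInf ψ₂₂)
    (hcoercive₁ : ∀ x, ψ₁₁ ‖x‖ ≤ V₁ x ∧ V₁ x ≤ ψ₁₂ ‖x‖)
    (hcoercive₂ : ∀ x, ψ₂₁ ‖x‖ ≤ V₂ x ∧ V₂ x ≤ ψ₂₂ ‖x‖)
    (χ₁₂ χ₂₁ χ₁u χ₂u α₁ α₂ : ℝ → ℝ)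
    (hχ₁₂ : ClassKInf χ₁₂ ∨ ∀ r, 0 ≤ r → χ₁₂ r = 0)
    (hχ₂₁ : ClassKInf χ₂₁ ∨ ∀ r, 0 ≤ r → χ₂₁ r = 0)
    (hχ₁u : ClassK χ₁u) (hχ₂u : ClassK χ₂u) (hα₁ : ClassPD α₁) (hα₂ : ClassPD α₂)
    -- implications for the Lie derivatives along the trajectories of the subsystems
    (hdecay₁ : ∀ (x₁ : X₁) (x₂ : ℝ → X₂) (u : ℝ → U) (ξ : ℝ → X₁), IsPCb x₂ → IsPCb u →
      S.subsystem₁.IsSolution x₁ (fun t => (x₂ t, u t)) ⊤ ξ →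
      max (χ₁₂ (V₂ (x₂ 0))) (χ₁u (inputNorm u)) < V₁ x₁ →
      lieDerivative V₁ ξ ≤ ((-α₁ (V₁ x₁) : ℝ) : EReal))
    (hdecay₂ : ∀ (x₂ : X₂) (x₁ : ℝ → X₁) (u : ℝ → U) (ξ : ℝ → X₂), IsPCb x₁ → IsPCb u →
      S.subsystem₂.IsSolution x₂ (fun t => (x₁ t, u t)) ⊤ ξ →
      max (χ₂₁ (V₁ (x₁ 0))) (χ₂u (inputNorm u)) < V₂ x₂ →
      lieDerivative V₂ ξ ≤ ((-α₂ (V₂ x₂) : ℝ) : EReal))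
    -- small-gain condition
    (hsg : ∀ r, 0 < r → χ₁₂ (χ₂₁ r) < r) :
    S.interconnection.IsISS := by
  obtain ⟨β, γ, hβ, hγ, hest⟩ := S.exists_iss_estimate hfc₁ hfc₂ hV₁ hV₂ hψ₁₁ hψ₁₂ hψ₂₁ hψ₂₂
    hcoercive₁ hcoercive₂ hχ₁₂ hχ₂₁ hχ₁u hχ₂u hα₁ hα₂ hdecay₁ hdecay₂ hsg
  refine ⟨fun x u hu => ?_, β, γ, hβ, hγ, fun x u hu ξ hξ t ht =>
    hest x u ⊤ ξ hu hξ t ⟨ht, EReal.coe_lt_top t⟩⟩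
  obtain ⟨b, ξ, hξ, -⟩ := hwp x u hu
  -- The estimate is already valid on [0, b), and β ‖x‖ t ≤ β ‖x‖ 0 makes it uniform in t, so the
  -- solution continues to all times.
  have hb : b = ⊤ := hbic x u b ξ hu hξ ⟨β ‖x‖ 0 + γ (inputNorm u), fun t ht =>
    (hest x u b ξ hu hξ.1 t ht).trans (add_le_add_left
      (hβ.le_initial (norm_nonneg x) ht.1) _)⟩
  exact ⟨ξ, hb ▸ hξ.1⟩
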